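/- **Setting.** Let $\mathcal X,\mathcal Y,\hat{\mathcal X}_1,\hat{\mathcal X}_2$ be finite alphabets, $P_0$ a probability distribution on $\mathcal X\times\mathcal Y$ and $P(\hat x_1,\hat x_2|x,y)$ a conditional distribution on $\hat{\mathcal X}_1\times\hat{\mathcal X}_2$ given $(x,y)\in\mathcal X\times\mathcal Y$. The pairs $(X_i,Y_i)$, $i=1,2,\dots$, are i.i.d. $\sim P_0$. A cascade code of blocklength $n$ at rates $(R_1,R_2)\in\mathbb R^2$, with side information $Y^n$ at the source encoder and at User 1 but not at User 2, has message sets $\mathcal M_i$ with $\lfloor 2^{nR_i}\rfloor$ elements and consists of encoders $f_1:\mathcal X^n\times\mathcal Y^n\to\mathcal M_1$, $f_2:\mathcal Y^n\times\mathcal M_1\to\mathcal M_2$ and decoders $g_1:\mathcal Y^n\times\mathcal M_1\to\hat{\mathcal X}_1^n$, $g_2:\mathcal M_2\to\hat{\mathcal X}_2^n$; with $T_1=f_1(X^n,Y^n)$ and $T_2=f_2(Y^n,T_1)$ it produces $\hat X_1^n=g_1(Y^n,T_1)$ and $\hat X_2^n=g_2(T_2)$. In a code with common randomness, the four functions may also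 depend on a random variable $\omega$ with finite alphabet, independent of $(X^n,Y^n)$, whose alphabet and law are chosen with the code. The rate pair $(R_1,R_2)$ *achieves* empirical coordination toward $P_0(x,y)P(\hat x_1,\hat x_2|x,y)$ if there is a sequence of such codes, $n=1,2,\dots$, for which the total variation distance between the joint type (empirical distribution) of $(X^n,Y^n,\hat X_1^n,\hat X_2^n)$ and $P_0(x,y)P(\hat x_1,\hat x_2|x,y)$ tends to $0$ in probability as $n\to\infty$. For fixed $P_0$, the coordination capacity region is the closure of the set of all tuples $(R_1,R_2,P(\cdot,\cdot|\cdot,\cdot))$ such that $(R_1,R_2)$ achieves empirical coordination toward $P_0P$ by codes with common randomness, and the rate-coordination region $R_{P_0}(P(\hat x_1,\hat x_2|x,y))$ is its slice at the given conditional distribution. **Theorem (Rate coordination in the cascade problem).** The rate-coordination region $R_{P_0}(P(\hat x_1,\hat x_2|x,y))$ is exactly the set of $(R_1,R_2)\in\mathbb R^2$ with $$R_2\ge I(X,Y;\hat X_2),\qquad R_1\ge I(X;\hat X_1,\hat X_2\,|\,Y),$$ where the mutual informations are in bits and evaluated under the joint distribution $P_0(x,y)P(\hat x_1,\hat x_2|x,y)$.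 The same set is also the closure of the set of rate pairs that achieve empirical coordination toward $P_0(x,y)P(\hat x_1,\hat x_2|x,y)$ itself by codes without common randomness. -/

import Mathlib

open Filter Topology

/-- Mutual information `I(A;B)`, in bits, of a pair of finite-alphabet random variables with
joint probability mass function `p`. -/
noncomputable def mutualInfo {A B : Type*} [Fintype A] [Fintype B] (p : A × B → ℝ) : ℝ :=
  ∑ a, ∑ b, p (a, b) * Real.logb 2 (p (a, b) / ((∑ b', p (a, b')) * ∑ a', p (a', b)))

/-- Conditional mutual information `I(A;B|C)`, in bits, of three finite-alphabet random variables
with joint probability mass function `p`. -/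
noncomputable def condMutualInfo {A B C : Type*} [Fintype A] [Fintype B] [Fintype C]
    (p : A × B × C → ℝ) : ℝ :=
  ∑ a, ∑ b, ∑ c, p (a, b, c) *
    Real.logb 2 (p (a, b, c) * (∑ a', ∑ b', p (a', b', c)) /
      ((∑ b', p (a, b', c)) * ∑ a', p (a', b, c)))

/-- Total variation distance between two (mass) functions on a finite set. -/
noncomputable def tvDist {S : Type*} [Fintype S] (p q : S → ℝ) : ℝ :=
  (1 / 2) * ∑ s, |p s - q s|

open Classical in
/-- The joint type (empirical distribution) of a length-`n` sequence. -/
noncomputable def empiricalDist {S : Type*} {n : ℕ} (s : Fin n → S) (a : S) : ℝ :=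
  ((Finset.univ.filter fun i => s i = a).card : ℝ) / n

/-- The target distribution `P₀(x,y) P(x̂₁,x̂₂|x,y)`; its argument is `(x, y, x̂₁, x̂₂)`. -/
def targetDist {X Y X₁ X₂ : Type*} [Fintype X] [Fintype Y] [Fintype X₁] [Fintype X₂]
    (P₀ : stdSimplex ℝ (X × Y)) (Q : X × Y → stdSimplex ℝ (X₁ × X₂))
    (s : X × Y × X₁ × X₂) : ℝ :=
  P₀ (s.1, s.2.1) * Q (s.1, s.2.1) (s.2.2.1, s.2.2.2)

/-- A (deterministic) cascade code of blocklength `n` with side information at the source encoder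
and at the first user, with `M₁` messages on the first link and `M₂` on the second. -/
structure CascadeCode (X Y X₁ X₂ : Type*) (n M₁ M₂ : ℕ) where
  /-- the source encoder -/
  f₁ : (Fin n → X) → (Fin n → Y) → Fin M₁
  /-- the encoder at User 1 -/
  f₂ : (Fin n → Y) → Fin M₁ → Fin M₂
  /-- the decoder at User 1 -/
  g₁ : (Fin n → Y) → Fin M₁ → (Fin n → X₁)
  /-- the decoder at User 2 -/
  g₂ : Fin M₂ → (Fin n → X₂)

namespace CascadeCode

variable {X Y X₁ X₂ : Type*} {n M₁ M₂ : ℕ}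

/-- The sequence `(xᵢ, yᵢ, x̂₁ᵢ, x̂₂ᵢ)` produced by the code on source input `(xⁿ, yⁿ)`. -/
def output (C : CascadeCode X Y X₁ X₂ n M₁ M₂) (x : Fin n → X) (y : Fin n → Y) :
    Fin n → X × Y × X₁ × X₂ := fun i =>
  (x i, y i, C.g₁ y (C.f₁ x y) i, C.g₂ (C.f₂ y (C.f₁ x y)) i)

open Classical in
/-- The probability, for `(Xᵢ, Yᵢ)` i.i.d. with law `P₀`, that the joint type of the sequences
`(Xⁿ, Yⁿ, X̂₁ⁿ, X̂₂ⁿ)` is at total variation distance more than `ε` from `T`. -/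
noncomputable def errorProb [Fintype X] [Fintype Y] [Fintype X₁] [Fintype X₂]
    (C : CascadeCode X Y X₁ X₂ n M₁ M₂) (P₀ : stdSimplex ℝ (X × Y))
    (T : X × Y × X₁ × X₂ → ℝ) (ε : ℝ) : ℝ :=
  ∑ x : Fin n → X, ∑ y : Fin n → Y,
    if ε < tvDist (empiricalDist (C.output x y)) T then ∏ i, P₀ (x i, y i) else 0

end CascadeCode

/-- The number `⌊2^{nR}⌋` of messages at rate `R` and blocklength `n`. -/
noncomputable def numMessages (n : ℕ) (R : ℝ) : ℕ := ⌊(2 : ℝ) ^ ((n : ℝ) * R)⌋₊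

/-- The rate pair `R = (R₁, R₂)` achieves empirical coordination toward the target
`P₀(x,y) Q(x̂₁,x̂₂|x,y)` by deterministic codes: for some sequence of codes, the total variation
distance between the joint type and the target tends to zero in probability. -/
def Achievable {X Y X₁ X₂ : Type*} [Fintype X] [Fintype Y] [Fintype X₁] [Fintype X₂]
    (P₀ : stdSimplex ℝ (X × Y)) (Q : X × Y → stdSimplex ℝ (X₁ × X₂)) (R : ℝ × ℝ) : Prop :=
  ∃ C : ∀ n : ℕ, CascadeCode X Y X₁ X₂ n (numMessages n R.1) (numMessages n R.2),
    ∀ ε > 0, Tendsto (fun n => (C n).errorProb P₀ (targetDist P₀ Q) ε) atTop (𝓝 0)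

/-- Achievability of empirical coordination when all three nodes moreover share common randomness
`ω` with a finite alphabet (here `Fin (K n)`), a law `p n` chosen with the code, and independent of
the source: the four functions of the code may depend on `ω`. As there are finitely many
deterministic codes for each `n`, finite alphabets are no restriction. -/
def AchievableCR {X Y X₁ X₂ : Type*} [Fintype X] [Fintype Y] [Fintype X₁] [Fintype X₂]
    (P₀ : stdSimplex ℝ (X × Y)) (Q : X × Y → stdSimplex ℝ (X₁ × X₂)) (R : ℝ × ℝ) : Prop :=
  ∃ (K : ℕ → ℕ) (p : ∀ n, stdSimplex ℝ (Fin (K n)))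
    (C : ∀ n : ℕ, Fin (K n) → CascadeCode X Y X₁ X₂ n (numMessages n R.1) (numMessages n R.2)),
    ∀ ε > 0, Tendsto
      (fun n => ∑ ω, p n ω * (C n ω).errorProb P₀ (targetDist P₀ Q) ε) atTop (𝓝 0)

/-- The closure of the set of rate pairs that achieve the fixed target by deterministic codes. -/
def achievableRegion {X Y X₁ X₂ : Type*} [Fintype X] [Fintype Y] [Fintype X₁] [Fintype X₂]
    (P₀ : stdSimplex ℝ (X × Y)) (Q : X × Y → stdSimplex ℝ (X₁ × X₂)) : Set (ℝ × ℝ) :=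
  closure {R | Achievable P₀ Q R}

/-- The coordination capacity region: the closure of the set of all tuples of rates and
conditional distributions that are achievable. -/
def coordinationCapacityRegion {X Y : Type*} (X₁ X₂ : Type*)
    [Fintype X] [Fintype Y] [Fintype X₁] [Fintype X₂] (P₀ : stdSimplex ℝ (X × Y)) :
    Set ((ℝ × ℝ) × (X × Y → stdSimplex ℝ (X₁ × X₂))) :=
  closure {t | AchievableCR P₀ t.2 t.1}

/-- The rate-coordination region: the slice of the coordination capacity region at a fixed
conditional distribution. -/
def rateCoordinationRegion {X Y X₁ X₂ : Type*} [Fintype X] [Fintype Y] [Fintype X₁] [Fintype X₂]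
    (P₀ : stdSimplex ℝ (X × Y)) (Q : X × Y → stdSimplex ℝ (X₁ × X₂)) : Set (ℝ × ℝ) :=
  {R | (R, Q) ∈ coordinationCapacityRegion X₁ X₂ P₀}

/-- The rate pairs with `R₂ ≥ I(X,Y;X̂₂)` and `R₁ ≥ I(X;X̂₁,X̂₂|Y)`, where the joint law of
`(X, Y, X̂₁, X̂₂)` is the target distribution. -/
def informationRegion {X Y X₁ X₂ : Type*} [Fintype X] [Fintype Y] [Fintype X₁] [Fintype X₂]
    (P₀ : stdSimplex ℝ (X × Y)) (Q : X × Y → stdSimplex ℝ (X₁ × X₂)) : Set (ℝ × ℝ) :=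
  {R | mutualInfo (fun s : (X × Y) × X₂ => ∑ u : X₁, targetDist P₀ Q (s.1.1, s.1.2, u, s.2)) ≤ R.2 ∧
    condMutualInfo (fun s : X × (X₁ × X₂) × Y =>
      targetDist P₀ Q (s.1, s.2.2, s.2.1.1, s.2.1.2)) ≤ R.1}

/-! Both informations are means, under the target `T`, of base-two logarithms of likelihood ratios:
`pairRatio` for I(X,Y;X̂₂) and `condRatio` for I(X;X̂₁,X̂₂|Y). Along a typical sequence the product
of such a ratio is 2 to the power n(mean ± δ).

Achievability is a one-shot covering argument without binning. User 2's codewords v_j are drawn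
independently from the marginal of v. Given the codebook and y, the list used on the first link
consists of pairs (j, w) drawn with weight proportional to P(y, w | v_j), so the side information
itself selects plausible codewords. A list entry completing (x, y) to a typical tuple serves both
users. Averaging over lists and then over codebooks (`exists_conditional_covering`,
`exists_cascade_covering`) bounds the failure probability by 1/z + P(atypical) + A/M₂ + Az/(M₁B),
where A bounds `pairRatio` from above and B bounds `pairRatio`/`condRatio` from below on typical
tuples. The weak law and the choice of exponents make this vanish strictly inside the region;
diagonalizing over the tolerance gives one sequence of codes.

The converse is a change of measure. For a fixed message the reconstructions are determined (given
y, on the first link), so the product of the ratios has mean at most 1 under the source. Summed over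
all M messages the mean is at most M, yet on the typical event the message actually sent already
contributes about 2^{nI}; hence M is at least about 2^{nI}. Only error probability 1/2 at a small
positive tolerance is needed, so perturbations of rates and target are harmless and common
randomness can be fixed at a good value. The regions then form a cycle of inclusions. -/

/-! ### Types of sequences and the weak law of large numbers -/

/-- Summing a product over all sequences is the product of the letterwise sums. -/
theorem sum_prod_seq {n : ℕ} {S : Type*} [Fintype S] (f : Fin n → S → ℝ) :
    ∑ s : Fin n → S, ∏ i, f i (s i) = ∏ i, ∑ a, f i a := by
  classical
  rw [Finset.prod_univ_sum, Fintype.piFinset_univ]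

theorem sum_eq_empiricalDist {n : ℕ} {S : Type*} [Fintype S] (s : Fin n → S) (f : S → ℝ) :
    ∑ i, f (s i) = n * ∑ a, empiricalDist s a * f a := by
  classical
  rcases Nat.eq_zero_or_pos n with rfl | hn
  · simp
  have hn' : (n : ℝ) ≠ 0 := by positivity
  rw [Finset.mul_sum]
  have : ∀ a, (n : ℝ) * (empiricalDist s a * f a) = ∑ i, if s i = a then f a else 0 := by
    intro a
    rw [← Finset.sum_filter, Finset.sum_const, nsmul_eq_mul, empiricalDist]
    field_simp
  simp_rw [this]
  rw [Finset.sum_comm]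
  simp

/-- Grouping the sum by letters leaves the difference of the two mass functions tested against `f`;
its ℓ¹ norm is twice the total variation distance. -/
theorem abs_sum_sub_le_tvDist {n : ℕ} {S : Type*} [Fintype S] (s : Fin n → S) (T f : S → ℝ)
    {C : ℝ} (hf : ∀ a, |f a| ≤ C) :
    |∑ i, f (s i) - n * ∑ a, T a * f a| ≤ n * (2 * C * tvDist (empiricalDist s) T) := by
  rw [sum_eq_empiricalDist, ← mul_sub, ← Finset.sum_sub_distrib, abs_mul, Nat.abs_cast]
  refine mul_le_mul_of_nonneg_left ?_ (Nat.cast_nonneg n)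
  refine (Finset.abs_sum_le_sum_abs _ _).trans ?_
  have : 2 * C * tvDist (empiricalDist s) T = ∑ a, |empiricalDist s a - T a| * C := by
    rw [tvDist, ← Finset.sum_mul]; ring
  rw [this]
  refine Finset.sum_le_sum fun a _ => ?_
  rw [← sub_mul, abs_mul]
  exact mul_le_mul_of_nonneg_left (hf a) (abs_nonneg _)

theorem tvDist_triangle {S : Type*} [Fintype S] (p q r : S → ℝ) :
    tvDist p r ≤ tvDist p q + tvDist q r := by
  rw [tvDist, tvDist, tvDist, ← mul_add, ← Finset.sum_add_distrib]
  exact mul_le_mul_of_nonneg_left (Finset.sum_le_sum fun a _ => abs_sub_le _ _ _) (by norm_num)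

theorem sum_seq_succ {n : ℕ} {S : Type*} [Fintype S] (g : (Fin (n + 1) → S) → ℝ) :
    ∑ s, g s = ∑ a, ∑ s : Fin n → S, g (Fin.cons a s) := by
  rw [← (Fin.consEquiv fun _ : Fin (n + 1) => S).sum_comp, Fintype.sum_prod_type]
  rfl

theorem sum_seq_centered {S : Type*} [Fintype S] (T h : S → ℝ)
    (hh : ∑ a, T a * h a = 0) (n : ℕ) :
    ∑ s : Fin n → S, (∏ i, T (s i)) * ∑ i, h (s i) = 0 := by
  induction n with
  | zero => simp
  | succ n ih =>
    rw [sum_seq_succ]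
    simp only [Fin.prod_univ_succ, Fin.sum_univ_succ, Fin.cons_zero, Fin.cons_succ]
    have e : ∀ (a : S) (s : Fin n → S), T a * (∏ i, T (s i)) * (h a + ∑ i, h (s i)) =
        T a * h a * (∏ i, T (s i)) + T a * ((∏ i, T (s i)) * ∑ i, h (s i)) := fun _ _ => by ring
    simp_rw [e, Finset.sum_add_distrib, ← Finset.mul_sum, ih, ← Finset.sum_mul, hh]
    simp

/-- Variance of an i.i.d. sum: splitting off the first letter, the cross term vanishes because the
letter function is centered. -/
theorem sum_seq_centered_sq {S : Type*} [Fintype S] (T h : S → ℝ) (hT : ∑ a, T a = 1)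
    (hh : ∑ a, T a * h a = 0) (n : ℕ) :
    ∑ s : Fin n → S, (∏ i, T (s i)) * (∑ i, h (s i)) ^ 2 = n * ∑ a, T a * h a ^ 2 := by
  induction n with
  | zero => simp
  | succ n ih =>
    rw [sum_seq_succ]
    simp only [Fin.prod_univ_succ, Fin.sum_univ_succ, Fin.cons_zero, Fin.cons_succ]
    have e : ∀ (a : S) (s : Fin n → S), T a * (∏ i, T (s i)) * (h a + ∑ i, h (s i)) ^ 2 =
        T a * h a ^ 2 * (∏ i, T (s i)) + 2 * (T a * h a) * ((∏ i, T (s i)) * ∑ i, h (s i)) +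
          T a * ((∏ i, T (s i)) * (∑ i, h (s i)) ^ 2) := fun _ _ => by ring
    have hp : ∑ s : Fin n → S, ∏ i, T (s i) = 1 := by
      rw [sum_prod_seq fun _ a => T a]; simp [hT]
    simp_rw [e, Finset.sum_add_distrib, ← Finset.mul_sum, ih, sum_seq_centered T h hh, hp,
      ← Finset.sum_mul, hT]
    push_cast; ring

/-- The frequency of a letter is an average of independent indicators, each of variance at most 1.
This feeds Chebyshev's inequality in the weak law. -/
theorem sum_seq_empiricalDist_sq_le {S : Type*} [Fintype S] (T : S → ℝ) (h0 : ∀ a, 0 ≤ T a)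
    (hT : ∑ a, T a = 1) {n : ℕ} (hn : 0 < n) (a : S) :
    ∑ s : Fin n → S, (∏ i, T (s i)) * (empiricalDist s a - T a) ^ 2 ≤ 1 / n := by
  classical
  have hn' : (0 : ℝ) < n := by exact_mod_cast hn
  set h : S → ℝ := fun b => (if b = a then 1 else 0) - T a with hdef
  have hh : ∑ b, T b * h b = 0 := by
    simp [hdef, mul_sub, Finset.sum_sub_distrib, ← Finset.sum_mul, hT]
  have e : ∀ s : Fin n → S, empiricalDist s a - T a = (∑ i, h (s i)) / n := by
    intro s
    simp only [hdef, Finset.sum_sub_distrib, Finset.sum_const, Finset.card_univ, Fintype.card_fin,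
      nsmul_eq_mul, empiricalDist, Finset.sum_boole]
    field_simp
  have hTa : T a ≤ 1 := hT ▸ Finset.single_le_sum (fun b _ => h0 b) (Finset.mem_univ a)
  have hsq : ∀ b, h b ^ 2 ≤ 1 := by
    intro b
    have := h0 a
    simp only [hdef]
    split_ifs <;> nlinarith
  simp_rw [e, div_pow, mul_div_assoc', ← Finset.sum_div]
  rw [sum_seq_centered_sq T h hT hh]
  have : ∑ b, T b * h b ^ 2 ≤ 1 := hT ▸ Finset.sum_le_sum fun b _ =>
    mul_le_of_le_one_right (h0 b) (hsq b)
  rw [div_le_div_iff₀ (by positivity) hn']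
  nlinarith [mul_le_mul_of_nonneg_left this (sq_nonneg (n : ℝ))]

open Classical in
/-- The weak law of large numbers for types: an i.i.d. sequence is typical with probability
tending to one. -/
theorem tendsto_sum_not_typical {S : Type*} [Fintype S] (T : S → ℝ) (h0 : ∀ a, 0 ≤ T a)
    (hT : ∑ a, T a = 1) {ε : ℝ} (hε : 0 < ε) :
    Tendsto (fun n : ℕ => ∑ s : Fin n → S,
      if ε < tvDist (empiricalDist s) T then ∏ i, T (s i) else 0) atTop (𝓝 0) := by
  have hlim : Tendsto (fun n : ℕ => (Fintype.card S : ℝ) ^ 2 / ε ^ 2 * (1 / (n : ℝ))) atTop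
      (𝓝 0) := by
    simpa using tendsto_one_div_atTop_nhds_zero_nat.const_mul ((Fintype.card S : ℝ) ^ 2 / ε ^ 2)
  refine squeeze_zero' (Eventually.of_forall fun n => Finset.sum_nonneg fun s _ => ?_) ?_ hlim
  · split_ifs
    exacts [Finset.prod_nonneg fun i _ => h0 _, le_rfl]
  filter_upwards [eventually_gt_atTop 0] with n hn
  have hp : ∀ s : Fin n → S, 0 ≤ ∏ i, T (s i) := fun s => Finset.prod_nonneg fun i _ => h0 _
  have key : ∀ s : Fin n → S, (if ε < tvDist (empiricalDist s) T then ∏ i, T (s i) else 0) ≤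
      (Fintype.card S / ε ^ 2) * ∑ a, (∏ i, T (s i)) * (empiricalDist s a - T a) ^ 2 := by
    intro s
    rw [← Finset.mul_sum]
    split_ifs with h
    · have h1 : tvDist (empiricalDist s) T ^ 2 ≤
          Fintype.card S * ∑ a, (empiricalDist s a - T a) ^ 2 := by
        have := sq_sum_le_card_mul_sum_sq (s := Finset.univ)
          (f := fun a => |empiricalDist s a - T a|)
        simp only [sq_abs, Finset.card_univ] at this
        rw [tvDist, mul_pow]
        nlinarith [sq_nonneg (∑ a, |empiricalDist s a - T a|)]
      have h2 : ε ^ 2 ≤ tvDist (empiricalDist s) T ^ 2 := by gcongr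
      have h3 : 1 ≤ (Fintype.card S * ∑ a, (empiricalDist s a - T a) ^ 2) / ε ^ 2 := by
        rw [one_le_div (by positivity)]; exact h2.trans h1
      calc ∏ i, T (s i) ≤ (∏ i, T (s i)) *
            ((Fintype.card S * ∑ a, (empiricalDist s a - T a) ^ 2) / ε ^ 2) :=
            le_mul_of_one_le_right (hp s) h3
        _ = _ := by ring
    · exact mul_nonneg (by positivity)
        (mul_nonneg (hp s) (Finset.sum_nonneg fun a _ => sq_nonneg _))
  refine (Finset.sum_le_sum fun s _ => key s).trans ?_
  rw [← Finset.mul_sum, Finset.sum_comm]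
  have : ∑ a : S, ∑ s : Fin n → S, (∏ i, T (s i)) * (empiricalDist s a - T a) ^ 2 ≤
      Fintype.card S * (1 / (n : ℝ)) := by
    refine (Finset.sum_le_sum fun a _ => sum_seq_empiricalDist_sq_le T h0 hT hn a).trans ?_
    simp
  refine (mul_le_mul_of_nonneg_left this (by positivity)).trans (le_of_eq ?_)
  ring

/-! ### One-shot covering lemmas -/

/-- Follows from exp(-t) ≤ 1/(1+t). Unlike the bound 1 - (1 - exp(-k))h given by convexity, the
coefficient k/(1+k) has an explicit reciprocal 1 + 1/k, which separates the two rate conditions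
later. -/
theorem exp_neg_mul_le {k h : ℝ} (hk : 0 ≤ k) (h0 : 0 ≤ h) (h1 : h ≤ 1) :
    Real.exp (-(k * h)) ≤ 1 - k / (1 + k) * h := by
  have hkh : 0 ≤ k * h := mul_nonneg hk h0
  have e1 : Real.exp (-(k * h)) ≤ 1 / (1 + k * h) := by
    rw [Real.exp_neg, ← one_div]
    exact one_div_le_one_div_of_le (by positivity) (by linarith [Real.add_one_le_exp (k * h)])
  refine e1.trans ?_
  rw [div_le_iff₀ (by positivity)]
  have : (1 - k / (1 + k) * h) * (1 + k * h) - 1 = k ^ 2 * (h * (1 - h)) / (1 + k) := by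
    field_simp; ring
  have : 0 ≤ k ^ 2 * (h * (1 - h)) / (1 + k) := by
    have := sub_nonneg.2 h1
    positivity
  linarith

/-- A weighted average dominates some value. -/
theorem exists_le_of_sum_mul_le {ι : Type*} [Fintype ι] (w f : ι → ℝ) (hw : ∀ i, 0 ≤ w i)
    (h1 : ∑ i, w i = 1) {b : ℝ} (h : ∑ i, w i * f i ≤ b) : ∃ i, f i ≤ b := by
  by_contra! hc
  have : ∑ i, w i * b < ∑ i, w i * f i := by
    obtain ⟨j, hj⟩ : ∃ j, 0 < w j := by
      by_contra! hn
      linarith [Finset.sum_nonpos fun i (_ : i ∈ Finset.univ) => hn i]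
    exact Finset.sum_lt_sum (fun i _ => mul_le_mul_of_nonneg_left (hc i).le (hw i))
      ⟨j, Finset.mem_univ j, mul_lt_mul_of_pos_left (hc j) hj⟩
  rw [← Finset.sum_mul, h1, one_mul] at this
  linarith

open Classical in
/-- A random list of `M` elements drawn with weights `g` meets the random set `{u | G a u}` with
the expected probability; hence so does some list. -/
theorem exists_list_covering {A U : Type*} [Fintype A] [Fintype U] [Nonempty U] (p : A → ℝ)
    (hp : ∀ a, 0 ≤ p a) (g : U → ℝ) (hg : ∀ u, 0 ≤ g u) (G : A → U → Prop) (M : ℕ) :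
    ∃ φ : Fin M → U, ∑ a, (if ∃ m, G a (φ m) then 0 else p a) ≤
      ∑ a, p a * Real.exp (-(M * ((∑ u, if G a u then g u else 0) / ∑ u, g u))) := by
  -- If all weights vanish, the quotient in the exponent is 0 by convention and the bound is trivial
  -- for any list.
  rcases (Finset.sum_nonneg fun u (_ : u ∈ Finset.univ) => hg u).eq_or_lt with hS | hS
  · refine ⟨fun _ => Classical.arbitrary U, Finset.sum_le_sum fun a _ => ?_⟩
    rw [← hS]
    split_ifs <;> simp [hp a]
  set S := ∑ u, g u with hSdef
  refine exists_le_of_sum_mul_le (fun φ : Fin M → U => ∏ m, g (φ m) / S) _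
    (fun φ => Finset.prod_nonneg fun m _ => div_nonneg (hg _) hS.le) ?_ ?_
  · rw [← Fintype.piFinset_univ, ← Finset.prod_univ_sum (fun _ => Finset.univ)
      (fun (_ : Fin M) u => g u / S), ← Finset.sum_div, div_self hS.ne']
    simp
  simp_rw [Finset.mul_sum]
  rw [Finset.sum_comm]
  refine Finset.sum_le_sum fun a _ => ?_
  set q := (∑ u, if G a u then g u else 0) / S with hq
  have e : ∀ φ : Fin M → U, (∏ m, g (φ m) / S) * (if ∃ m, G a (φ m) then 0 else p a) =
      p a * ∏ m, (if G a (φ m) then 0 else g (φ m) / S) := by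
    intro φ
    split_ifs with h
    · obtain ⟨m, hm⟩ := h
      have h0 : ∏ m, (if G a (φ m) then 0 else g (φ m) / S) = 0 :=
        Finset.prod_eq_zero (Finset.mem_univ m) (if_pos hm)
      rw [h0, mul_zero, mul_zero]
    · push Not at h
      rw [mul_comm]
      congr 1
      exact Finset.prod_congr rfl fun m _ => by simp [h m]
  simp_rw [e, ← Finset.mul_sum]
  refine mul_le_mul_of_nonneg_left ?_ (hp a)
  rw [← Fintype.piFinset_univ, ← Finset.prod_univ_sum (fun _ => Finset.univ)
      (fun (_ : Fin M) u => if G a u then 0 else g u / S)]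
  have hsum : ∑ u, (if G a u then 0 else g u / S) = 1 - q := by
    rw [eq_sub_iff_add_eq, hq, Finset.sum_div, ← Finset.sum_add_distrib,
      ← div_self hS.ne', hSdef, Finset.sum_div, ← hSdef]
    exact Finset.sum_congr rfl fun u _ => by split_ifs <;> simp
  have hq0 : 0 ≤ 1 - q := hsum ▸ Finset.sum_nonneg fun u _ => by
    split_ifs
    exacts [le_rfl, div_nonneg (hg u) hS.le]
  rw [hsum, Finset.prod_const, Finset.card_univ, Fintype.card_fin, ← mul_neg, Real.exp_nat_mul]
  exact pow_le_pow_left₀ hq0 (Real.one_sub_le_exp_neg q) M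

open Classical in
/-- Covering at User 1 for a fixed codebook `c` of User 2: each list entry consists of an index
into the codebook and a reconstruction for User 1, drawn given the side information. -/
theorem exists_conditional_covering {X Y W V : Type*} [Fintype X] [Fintype Y] [Fintype W]
    [Nonempty W] (t : X → Y → W → V → ℝ) (txyv : X → Y → V → ℝ) (tywv : Y → W → V → ℝ)
    (txy : X → Y → ℝ) (tv : V → ℝ) (ty : Y → ℝ) (F : X → Y → W → V → Prop)
    (hywv : ∀ y w v, 0 ≤ tywv y w v) (hxy : ∀ x y, 0 ≤ txy x y) (hv : ∀ v, 0 ≤ tv v)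
    (hv_sum : ∀ v, ∑ y, ∑ w, tywv y w v = tv v) (hy_sum : ∀ y, ∑ x, txy x y = ty y)
    (hF : ∀ x y w v, F x y w v → 0 < txyv x y v ∧ 0 < tv v)
    {B z : ℝ} (hB : 0 < B) (hz : 0 < z)
    (hFB : ∀ x y w v, F x y w v → B * (ty y * tv v * t x y w v) ≤ tywv y w v * txyv x y v)
    {M₁ M₂ : ℕ} (hM₂ : 0 < M₂) (c : Fin M₂ → V) :
    ∃ φ : Y → Fin M₁ → Fin M₂ × W,
      ∑ x, ∑ y, (if ∃ m, F x y (φ y m).2 (c (φ y m).1) then 0 else txy x y) ≤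
        1 / z + ∑ x, ∑ y, txy x y * Real.exp (-(M₁ * B / (z * M₂) *
          ∑ j, ∑ w, if F x y w (c j) then t x y w (c j) / txyv x y (c j) else 0)) := by
  have : Nonempty (Fin M₂) := ⟨⟨0, hM₂⟩⟩
  have hM : (0 : ℝ) < M₂ := by exact_mod_cast hM₂
  set H : X → Y → ℝ := fun x y =>
    ∑ j, ∑ w, if F x y w (c j) then t x y w (c j) / txyv x y (c j) else 0 with hH
  -- The weight of (j, w) is P(y, w | v_j). Its total over (j, w) is Σ_j P(y | v_j), the normalizer
  -- of the list distribution.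
  set g : Y → Fin M₂ × W → ℝ := fun y u => tywv y u.2 (c u.1) / tv (c u.1) with hg
  have hg0 : ∀ y u, 0 ≤ g y u := fun y u => div_nonneg (hywv _ _ _) (hv _)
  have hty : ∀ y, 0 ≤ ty y := fun y => hy_sum y ▸ Finset.sum_nonneg fun x _ => hxy x y
  choose φ hφ using fun y => exists_list_covering (fun x => txy x y) (fun x => hxy x y) (g y)
    (hg0 y) (fun x u => F x y u.2 (c u.1)) M₁
  refine ⟨φ, ?_⟩
  have hgH : ∀ x y, B * ty y * H x y ≤ ∑ u, if F x y u.2 (c u.1) then g y u else 0 := by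
    intro x y
    rw [Fintype.sum_prod_type, hH, Finset.mul_sum]
    refine Finset.sum_le_sum fun j _ => ?_
    rw [Finset.mul_sum]
    refine Finset.sum_le_sum fun w _ => ?_
    split_ifs with h
    · obtain ⟨h1, h2⟩ := hF _ _ _ _ h
      rw [hg, mul_div_assoc', div_le_div_iff₀ h1 h2]
      linarith [hFB _ _ _ _ h]
    · simp
  have hpt : ∀ x y, txy x y * Real.exp (-(M₁ * ((∑ u, if F x y u.2 (c u.1) then g y u else 0) /
      ∑ u, g y u))) ≤ txy x y * ((∑ u, g y u) / (z * M₂ * ty y)) +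
        txy x y * Real.exp (-(M₁ * B / (z * M₂) * H x y)) := by
    intro x y
    rw [← mul_add]
    rcases (hxy x y).eq_or_lt with h0 | h0
    · simp [← h0]
    have hy0 : 0 < ty y := h0.trans_le <| hy_sum y ▸
      Finset.single_le_sum (f := fun x => txy x y) (fun x _ => hxy x y) (Finset.mem_univ x)
    refine mul_le_mul_of_nonneg_left ?_ h0.le
    have hS0 : 0 ≤ ∑ u, g y u := Finset.sum_nonneg fun u _ => hg0 y u
    have hG0 : 0 ≤ ∑ u, if F x y u.2 (c u.1) then g y u else 0 :=
      Finset.sum_nonneg fun u _ => by split_ifs; exacts [hg0 y u, le_rfl]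
    have hGS : (∑ u, if F x y u.2 (c u.1) then g y u else 0) ≤ ∑ u, g y u :=
      Finset.sum_le_sum fun u _ => by split_ifs; exacts [le_rfl, hg0 y u]
    have hgHxy := hgH x y
    set S := ∑ u, g y u
    set G := ∑ u, if F x y u.2 (c u.1) then g y u else 0
    -- Markov's inequality in pointwise form: a normalizer of moderate size gives the exponential
    -- term, while an excessive one is charged to the first term, whose total is at most 1/z because
    -- the normalizers sum to at most M₂.
    rcases le_or_gt S (z * M₂ * ty y) with hS | hS
    · refine le_add_of_nonneg_of_le (by positivity) (Real.exp_le_exp.2 (neg_le_neg ?_))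
      rcases hS0.eq_or_lt with h | h
      · have : H x y ≤ 0 := by
          by_contra! hc
          have : 0 < B * ty y * H x y := by positivity
          linarith
        refine (mul_nonpos_of_nonneg_of_nonpos (by positivity) this).trans (by positivity)
      · have : M₁ * B / (z * M₂) * H x y = M₁ * (B * ty y * H x y / (z * M₂ * ty y)) := by
          field_simp
        rw [this]
        refine mul_le_mul_of_nonneg_left ?_ (Nat.cast_nonneg _)
        exact (div_le_div_of_nonneg_right hgHxy (by positivity)).trans
          (div_le_div_of_nonneg_left hG0 h hS)
    · refine le_add_of_le_of_nonneg (le_trans (Real.exp_le_one_iff.2 ?_)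
        ((one_le_div (by positivity)).2 hS.le)) (Real.exp_pos _).le
      have : 0 ≤ M₁ * (G / S) := by positivity
      linarith
  have hS : ∑ y, ∑ u, g y u ≤ M₂ := by
    simp_rw [Fintype.sum_prod_type]
    rw [Finset.sum_comm]
    have : ∀ j, ∑ y, ∑ w, g y (j, w) ≤ 1 := by
      intro j
      simp only [hg, ← Finset.sum_div, hv_sum]
      exact div_self_le_one _
    simpa using Finset.sum_le_sum fun j (_ : j ∈ Finset.univ) => this j
  rw [Finset.sum_comm]
  refine (Finset.sum_le_sum fun y _ => (hφ y).trans (Finset.sum_le_sum fun x _ => hpt x y)).trans ?_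
  simp_rw [Finset.sum_add_distrib]
  rw [Finset.sum_comm (f := fun x y => txy x y * Real.exp _)]
  refine add_le_add_left ?_ _
  have : ∀ y, ∑ x, txy x y * ((∑ u, g y u) / (z * M₂ * ty y)) ≤ (∑ u, g y u) / (z * M₂) := by
    intro y
    rw [← Finset.sum_mul, hy_sum]
    rcases (hty y).eq_or_lt with h | h
    · rw [← h, zero_mul]
      exact div_nonneg (Finset.sum_nonneg fun u _ => hg0 y u) (by positivity)
    · refine le_of_eq ?_
      field_simp
  refine (Finset.sum_le_sum fun y _ => this y).trans ?_
  rw [← Finset.sum_div, div_le_div_iff₀ (by positivity) hz]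
  nlinarith

open Classical in
/-- One-shot achievability for the cascade network: a codebook `c` for User 2 and, for each value
of the side information, a list `φ y` of pairs (codebook index, reconstruction of User 1), such
that with high probability some list entry completes `(x, y)` to an element of `F`. -/
theorem exists_cascade_covering {X Y W V : Type*} [Fintype X] [Fintype Y] [Fintype W] [Fintype V]
    [Nonempty W] (t : X → Y → W → V → ℝ) (txyv : X → Y → V → ℝ) (tywv : Y → W → V → ℝ)
    (txy : X → Y → ℝ) (tv : V → ℝ) (ty : Y → ℝ) (F : X → Y → W → V → Prop)
    (ht : ∀ x y w v, 0 ≤ t x y w v) (hywv : ∀ y w v, 0 ≤ tywv y w v) (hv : ∀ v, 0 ≤ tv v)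
    (hxyv_sum : ∀ x y v, ∑ w, t x y w v = txyv x y v)
    (hxy_sum : ∀ x y, ∑ v, txyv x y v = txy x y)
    (hv_sum : ∀ v, ∑ y, ∑ w, tywv y w v = tv v) (hy_sum : ∀ y, ∑ x, txy x y = ty y)
    (hv_one : ∑ v, tv v = 1) (hxy_one : ∑ x, ∑ y, txy x y = 1)
    (hF : ∀ x y w v, F x y w v → 0 < tv v)
    {A B z : ℝ} (hA : 0 < A) (hB : 0 < B) (hz : 0 < z)
    (hFA : ∀ x y w v, F x y w v → 0 < txyv x y v ∧ txyv x y v ≤ A * (txy x y * tv v))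
    (hFB : ∀ x y w v, F x y w v → B * (ty y * tv v * t x y w v) ≤ tywv y w v * txyv x y v)
    {M₁ M₂ : ℕ} (hM₁ : 0 < M₁) (hM₂ : 0 < M₂) :
    ∃ (c : Fin M₂ → V) (φ : Y → Fin M₁ → Fin M₂ × W),
      ∑ x, ∑ y, (if ∃ m, F x y (φ y m).2 (c (φ y m).1) then 0 else txy x y) ≤
        1 / z + (∑ x, ∑ y, ∑ w, ∑ v, (if F x y w v then 0 else t x y w v) +
          (A / M₂ + A * z / (M₁ * B))) := by
  have hM1 : (0 : ℝ) < M₁ := by exact_mod_cast hM₁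
  have hM2 : (0 : ℝ) < M₂ := by exact_mod_cast hM₂
  have hxyv : ∀ x y v, 0 ≤ txyv x y v := fun x y v =>
    hxyv_sum x y v ▸ Finset.sum_nonneg fun w _ => ht x y w v
  have hxy : ∀ x y, 0 ≤ txy x y := fun x y =>
    hxy_sum x y ▸ Finset.sum_nonneg fun v _ => hxyv x y v
  set κ : ℝ := M₁ * B / (z * M₂) with hκ
  have hκ0 : 0 < κ := by positivity
  -- The conditional probability of `F` given (x, y, v).
  set h : X → Y → V → ℝ := fun x y v => ∑ w, if F x y w v then t x y w v / txyv x y v else 0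
    with hh
  have hh0 : ∀ x y v, 0 ≤ h x y v := fun x y v => Finset.sum_nonneg fun w _ => by
    split_ifs
    exacts [div_nonneg (ht _ _ _ _) (hxyv _ _ _), le_rfl]
  have hh1 : ∀ x y v, h x y v ≤ 1 := by
    intro x y v
    calc h x y v ≤ ∑ w, t x y w v / txyv x y v := Finset.sum_le_sum fun w _ => by
          split_ifs
          exacts [le_rfl, div_nonneg (ht _ _ _ _) (hxyv _ _ _)]
      _ ≤ 1 := by
          rw [← Finset.sum_div, hxyv_sum]
          exact div_self_le_one _
  suffices hc : ∃ c : Fin M₂ → V, ∑ x, ∑ y, txy x y * Real.exp (-(κ * ∑ j, h x y (c j))) ≤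
      ∑ x, ∑ y, ∑ w, ∑ v, (if F x y w v then 0 else t x y w v) +
          (A / M₂ + A * z / (M₁ * B)) by
    obtain ⟨c, hc⟩ := hc
    obtain ⟨φ, hφ⟩ := exists_conditional_covering t txyv tywv txy tv ty F hywv hxy hv hv_sum
      hy_sum (fun x y w v hf => ⟨(hFA x y w v hf).1, hF x y w v hf⟩) hB hz hFB (M₁ := M₁) hM₂ c
    exact ⟨c, φ, hφ.trans (add_le_add_right hc _)⟩
  refine exists_le_of_sum_mul_le (fun c : Fin M₂ → V => ∏ j, tv (c j)) _
    (fun c => Finset.prod_nonneg fun j _ => hv _) ?_ ?_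
  · rw [← Fintype.piFinset_univ, ← Finset.prod_univ_sum (fun _ => Finset.univ)
      (fun (_ : Fin M₂) v => tv v), hv_one]
    simp
  -- The exponent produced by M₂ independent codewords. Its reciprocal splits into the error terms
  -- of the second and of the first link.
  set lam : ℝ := M₂ * (κ / (1 + κ)) / A with hlam
  have hlam0 : 0 < lam := by positivity
  have hlam1 : 1 / lam = A / M₂ + A * z / (M₁ * B) := by
    rw [hlam, hκ]; field_simp; ring
  have hE : ∀ x y, ∑ w, ∑ v, (if F x y w v then t x y w v else 0) ≤
      A * txy x y * ∑ v, tv v * h x y v := by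
    intro x y
    rw [Finset.sum_comm, Finset.mul_sum]
    refine Finset.sum_le_sum fun v _ => ?_
    rw [hh, Finset.mul_sum, Finset.mul_sum]
    refine Finset.sum_le_sum fun w _ => ?_
    split_ifs with hf
    · obtain ⟨h1, h2⟩ := hFA x y w v hf
      have : t x y w v = txyv x y v * (t x y w v / txyv x y v) := by field_simp
      calc t x y w v = txyv x y v * (t x y w v / txyv x y v) := this
        _ ≤ A * (txy x y * tv v) * (t x y w v / txyv x y v) :=
          mul_le_mul_of_nonneg_right h2 (div_nonneg (ht _ _ _ _) h1.le)
        _ = _ := by ring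
    · simp
  -- Independence turns the mean over codebooks into an M₂-th power. `exp_neg_mul_le` is applied
  -- twice: to a single codeword with `κ`, then to the conditional probability of `F` given (x, y)
  -- with `lam`.
  have havg : ∀ x y, txy x y * (∑ v, tv v * Real.exp (-(κ * h x y v))) ^ M₂ ≤
      txy x y - ∑ w, ∑ v, (if F x y w v then t x y w v else 0) + txy x y / lam := by
    intro x y
    have hE' := hE x y
    have hP0 : 0 ≤ ∑ w, ∑ v, (if F x y w v then t x y w v else 0) :=
      Finset.sum_nonneg fun w _ => Finset.sum_nonneg fun v _ => by
        split_ifs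
        exacts [ht _ _ _ _, le_rfl]
    have hP1 : ∑ w, ∑ v, (if F x y w v then t x y w v else 0) ≤ txy x y := by
      rw [← hxy_sum, Finset.sum_comm]
      refine Finset.sum_le_sum fun v _ => ?_
      rw [← hxyv_sum]
      exact Finset.sum_le_sum fun w _ => by split_ifs; exacts [le_rfl, ht _ _ _ _]
    set P := ∑ w, ∑ v, (if F x y w v then t x y w v else 0)
    set E := ∑ v, tv v * h x y v
    rcases (hxy x y).eq_or_lt with h0 | h0
    · rw [← h0] at hP1 ⊢
      simp [le_antisymm hP1 hP0]
    have h1 : ∑ v, tv v * Real.exp (-(κ * h x y v)) ≤ 1 - κ / (1 + κ) * E := by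
      refine le_trans (b := ∑ v, tv v - κ / (1 + κ) * E) ?_ (by rw [hv_one])
      rw [Finset.mul_sum, ← Finset.sum_sub_distrib]
      refine Finset.sum_le_sum fun v _ => ?_
      have := mul_le_mul_of_nonneg_left (exp_neg_mul_le hκ0.le (hh0 x y v) (hh1 x y v)) (hv v)
      linarith
    have h2 : (∑ v, tv v * Real.exp (-(κ * h x y v))) ^ M₂ ≤
        Real.exp (-(lam * (P / txy x y))) := by
      calc _ ≤ (Real.exp (-(κ / (1 + κ) * E))) ^ M₂ :=
            pow_le_pow_left₀ (Finset.sum_nonneg fun v _ => mul_nonneg (hv v) (Real.exp_pos _).le)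
              (h1.trans (Real.one_sub_le_exp_neg _)) _
        _ = Real.exp (-(lam * (A * E))) := by
            rw [← Real.exp_nat_mul]; congr 1; rw [hlam]; field_simp
        _ ≤ _ := by
            refine Real.exp_le_exp.2 (neg_le_neg (mul_le_mul_of_nonneg_left ?_ hlam0.le))
            rw [div_le_iff₀ h0]
            linarith
    have h3 := exp_neg_mul_le hlam0.le (div_nonneg hP0 h0.le) ((div_le_one h0).2 hP1)
    have h4 : txy x y * (1 - lam / (1 + lam) * (P / txy x y)) =
        txy x y - P + P / (1 + lam) := by
      field_simp; ring
    have h5 : P / (1 + lam) ≤ txy x y / lam :=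
      div_le_div₀ h0.le hP1 hlam0 (by linarith)
    have := mul_le_mul_of_nonneg_left (h2.trans h3) h0.le
    linarith
  have hswap : ∑ c : Fin M₂ → V, (∏ j, tv (c j)) *
      ∑ x, ∑ y, txy x y * Real.exp (-(κ * ∑ j, h x y (c j))) =
      ∑ x, ∑ y, txy x y * (∑ v, tv v * Real.exp (-(κ * h x y v))) ^ M₂ := by
    simp_rw [Finset.mul_sum]
    rw [Finset.sum_comm]
    refine Finset.sum_congr rfl fun x _ => ?_
    rw [Finset.sum_comm]
    refine Finset.sum_congr rfl fun y _ => ?_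
    have e : (∑ v, tv v * Real.exp (-(κ * h x y v))) ^ M₂ =
        ∑ c : Fin M₂ → V, ∏ j, (tv (c j) * Real.exp (-(κ * h x y (c j)))) := by
      rw [← Fintype.piFinset_univ, ← Finset.prod_univ_sum (fun _ => Finset.univ)
        (fun (_ : Fin M₂) v => tv v * Real.exp (-(κ * h x y v)))]
      simp
    rw [e, Finset.mul_sum]
    refine Finset.sum_congr rfl fun c _ => ?_
    rw [Finset.prod_mul_distrib, ← Real.exp_sum, ← Finset.mul_sum, Finset.sum_neg_distrib,
      ← Finset.mul_sum]
    ring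
  rw [hswap]
  refine (Finset.sum_le_sum fun x _ => Finset.sum_le_sum fun y _ => havg x y).trans ?_
  have hlast : ∀ x y, ∑ w, ∑ v, (if F x y w v then 0 else t x y w v) =
      txy x y - ∑ w, ∑ v, (if F x y w v then t x y w v else 0) := by
    intro x y
    rw [← hxy_sum]
    simp_rw [← hxyv_sum]
    rw [Finset.sum_comm (f := fun v w => t x y w v), ← Finset.sum_sub_distrib]
    refine Finset.sum_congr rfl fun w _ => ?_
    rw [← Finset.sum_sub_distrib]
    exact Finset.sum_congr rfl fun v _ => by split_ifs <;> simp
  simp_rw [hlast, Finset.sum_add_distrib, ← Finset.sum_div, hxy_one, hlam1]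
  exact le_rfl

/-! ### Marginals, likelihood ratios and nonnegativity of information -/

section Marginals

variable {X Y W V : Type*} [Fintype X] [Fintype Y] [Fintype W] [Fintype V]

/-- The marginal of `(x, y)`. -/
def margXY (T : X × Y × W × V → ℝ) (x : X) (y : Y) : ℝ := ∑ w, ∑ v, T (x, y, w, v)

/-- The marginal of `(x, y, v)`. -/
def margXYV (T : X × Y × W × V → ℝ) (x : X) (y : Y) (v : V) : ℝ := ∑ w, T (x, y, w, v)

/-- The marginal of `(y, w, v)`. -/
def margYWV (T : X × Y × W × V → ℝ) (y : Y) (w : W) (v : V) : ℝ := ∑ x, T (x, y, w, v)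

/-- The marginal of `v`. -/
def margV (T : X × Y × W × V → ℝ) (v : V) : ℝ := ∑ y, ∑ w, margYWV T y w v

/-- The marginal of `y`. -/
def margY (T : X × Y × W × V → ℝ) (y : Y) : ℝ := ∑ x, margXY T x y

/-- The likelihood ratio whose mean logarithm is `I(X;W,V|Y)`. -/
noncomputable def condRatio (T : X × Y × W × V → ℝ) (s : X × Y × W × V) : ℝ :=
  T s * margY T s.2.1 / (margXY T s.1 s.2.1 * margYWV T s.2.1 s.2.2.1 s.2.2.2)

/-- The likelihood ratio whose mean logarithm is `I(X,Y;V)`. -/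
noncomputable def pairRatio (T : X × Y × W × V → ℝ) (s : X × Y × W × V) : ℝ :=
  margXYV T s.1 s.2.1 s.2.2.2 / (margXY T s.1 s.2.1 * margV T s.2.2.2)

omit [Fintype X] [Fintype Y] in
theorem sum_margXYV (T : X × Y × W × V → ℝ) (x : X) (y : Y) :
    ∑ v, margXYV T x y v = margXY T x y := Finset.sum_comm

omit [Fintype V] in
theorem sum_margXYV_prod (T : X × Y × W × V → ℝ) (v : V) :
    ∑ a : X × Y, margXYV T a.1 a.2 v = margV T v := by
  simp only [margXYV, margV, margYWV]
  rw [Fintype.sum_prod_type, Finset.sum_comm]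
  exact Finset.sum_congr rfl fun y _ => Finset.sum_comm

omit [Fintype Y] in
theorem sum_margYWV (T : X × Y × W × V → ℝ) (y : Y) :
    ∑ w, ∑ v, margYWV T y w v = margY T y := by
  simp only [margYWV, margY, margXY]
  rw [Finset.sum_comm (f := fun x w => ∑ v, T (x, y, w, v))]
  exact Finset.sum_congr rfl fun w _ => Finset.sum_comm

theorem sum_margXY (T : X × Y × W × V → ℝ) : ∑ x, ∑ y, margXY T x y = ∑ s, T s := by
  simp only [margXY, Fintype.sum_prod_type]

theorem sum_margY (T : X × Y × W × V → ℝ) : ∑ y, margY T y = ∑ s, T s := by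
  rw [← sum_margXY, Finset.sum_comm]
  rfl

theorem sum_margV (T : X × Y × W × V → ℝ) : ∑ v, margV T v = ∑ s, T s := by
  simp_rw [← sum_margXYV_prod]
  rw [Finset.sum_comm]
  simp_rw [sum_margXYV]
  rw [Fintype.sum_prod_type, sum_margXY]

theorem mutualInfo_eq_sum (T : X × Y × W × V → ℝ) :
    mutualInfo (fun s : (X × Y) × V => ∑ u : W, T (s.1.1, s.1.2, u, s.2)) =
      ∑ s, T s * Real.logb 2 (pairRatio T s) := by
  have e : ∀ (x : X) (y : Y) (v : V), ∑ u, T (x, y, u, v) = margXYV T x y v := fun _ _ _ => rfl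
  simp only [mutualInfo, e, sum_margXYV, sum_margXYV_prod]
  simp only [Fintype.sum_prod_type, pairRatio]
  refine Finset.sum_congr rfl fun x _ => Finset.sum_congr rfl fun y _ => ?_
  rw [Finset.sum_comm]
  refine Finset.sum_congr rfl fun v _ => ?_
  rw [← Finset.sum_mul]
  rfl

theorem condMutualInfo_eq_sum (T : X × Y × W × V → ℝ) :
    condMutualInfo (fun s : X × (W × V) × Y => T (s.1, s.2.2, s.2.1.1, s.2.1.2)) =
      ∑ s, T s * Real.logb 2 (condRatio T s) := by
  simp only [condMutualInfo, Fintype.sum_prod_type, condRatio]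
  refine Finset.sum_congr rfl fun x _ => ?_
  simp_rw [Finset.sum_comm (t := (Finset.univ : Finset Y))]
  rfl

variable {T : X × Y × W × V → ℝ}

omit [Fintype X] [Fintype Y] in
theorem margXY_nonneg (h0 : ∀ s, 0 ≤ T s) (x : X) (y : Y) : 0 ≤ margXY T x y :=
  Finset.sum_nonneg fun _ _ => Finset.sum_nonneg fun _ _ => h0 _

omit [Fintype X] [Fintype Y] [Fintype V] in
theorem margXYV_nonneg (h0 : ∀ s, 0 ≤ T s) (x : X) (y : Y) (v : V) : 0 ≤ margXYV T x y v :=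
  Finset.sum_nonneg fun _ _ => h0 _

omit [Fintype Y] [Fintype W] [Fintype V] in
theorem margYWV_nonneg (h0 : ∀ s, 0 ≤ T s) (y : Y) (w : W) (v : V) : 0 ≤ margYWV T y w v :=
  Finset.sum_nonneg fun _ _ => h0 _

omit [Fintype V] in
theorem margV_nonneg (h0 : ∀ s, 0 ≤ T s) (v : V) : 0 ≤ margV T v :=
  Finset.sum_nonneg fun _ _ => Finset.sum_nonneg fun _ _ => margYWV_nonneg h0 _ _ _

omit [Fintype Y] in
theorem margY_nonneg (h0 : ∀ s, 0 ≤ T s) (y : Y) : 0 ≤ margY T y :=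
  Finset.sum_nonneg fun _ _ => margXY_nonneg h0 _ _

omit [Fintype Y] in
theorem condRatio_nonneg (h0 : ∀ s, 0 ≤ T s) (s : X × Y × W × V) : 0 ≤ condRatio T s :=
  div_nonneg (mul_nonneg (h0 _) (margY_nonneg h0 _))
    (mul_nonneg (margXY_nonneg h0 _ _) (margYWV_nonneg h0 _ _ _))

theorem pairRatio_nonneg (h0 : ∀ s, 0 ≤ T s) (s : X × Y × W × V) : 0 ≤ pairRatio T s :=
  div_nonneg (margXYV_nonneg h0 _ _ _) (mul_nonneg (margXY_nonneg h0 _ _) (margV_nonneg h0 _))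

omit [Fintype X] [Fintype Y] [Fintype V] in
theorem margXYV_pos (h0 : ∀ s, 0 ≤ T s) {s : X × Y × W × V} (h : 0 < T s) :
    0 < margXYV T s.1 s.2.1 s.2.2.2 :=
  Finset.sum_pos' (fun _ _ => h0 _) ⟨s.2.2.1, Finset.mem_univ _, h⟩

omit [Fintype X] [Fintype Y] in
theorem margXY_pos (h0 : ∀ s, 0 ≤ T s) {s : X × Y × W × V} (h : 0 < T s) :
    0 < margXY T s.1 s.2.1 := by
  rw [← sum_margXYV]
  exact Finset.sum_pos' (fun _ _ => margXYV_nonneg h0 _ _ _)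
    ⟨s.2.2.2, Finset.mem_univ _, margXYV_pos h0 h⟩

omit [Fintype Y] [Fintype W] [Fintype V] in
theorem margYWV_pos (h0 : ∀ s, 0 ≤ T s) {s : X × Y × W × V} (h : 0 < T s) :
    0 < margYWV T s.2.1 s.2.2.1 s.2.2.2 :=
  Finset.sum_pos' (fun _ _ => h0 _) ⟨s.1, Finset.mem_univ _, h⟩

omit [Fintype V] in
theorem margV_pos (h0 : ∀ s, 0 ≤ T s) {s : X × Y × W × V} (h : 0 < T s) :
    0 < margV T s.2.2.2 := by
  rw [← sum_margXYV_prod]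
  exact Finset.sum_pos' (fun _ _ => margXYV_nonneg h0 _ _ _)
    ⟨(s.1, s.2.1), Finset.mem_univ _, margXYV_pos h0 h⟩

omit [Fintype Y] in
theorem margY_pos (h0 : ∀ s, 0 ≤ T s) {s : X × Y × W × V} (h : 0 < T s) :
    0 < margY T s.2.1 :=
  Finset.sum_pos' (fun _ _ => margXY_nonneg h0 _ _) ⟨s.1, Finset.mem_univ _, margXY_pos h0 h⟩

omit [Fintype Y] in
theorem condRatio_pos (h0 : ∀ s, 0 ≤ T s) {s : X × Y × W × V} (h : 0 < T s) :
    0 < condRatio T s :=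
  div_pos (mul_pos h (margY_pos h0 h)) (mul_pos (margXY_pos h0 h) (margYWV_pos h0 h))

theorem pairRatio_pos (h0 : ∀ s, 0 ≤ T s) {s : X × Y × W × V} (h : 0 < T s) :
    0 < pairRatio T s :=
  div_pos (margXYV_pos h0 h) (mul_pos (margXY_pos h0 h) (margV_pos h0 h))

/-- Gibbs' inequality. -/
theorem sum_mul_logb_nonneg {S : Type*} [Fintype S] {T r : S → ℝ} (h0 : ∀ s, 0 ≤ T s)
    (h1 : ∑ s, T s = 1) (hr : ∀ s, 0 < T s → 0 < r s) (hs : ∑ s, T s / r s ≤ 1) :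
    0 ≤ ∑ s, T s * Real.logb 2 (r s) := by
  have hl : 0 < Real.log 2 := Real.log_pos one_lt_two
  simp only [Real.logb, mul_div_assoc']
  rw [← Finset.sum_div]
  refine div_nonneg (le_trans (sub_nonneg.2 hs) ?_) hl.le
  rw [← h1, ← Finset.sum_sub_distrib]
  refine Finset.sum_le_sum fun s _ => ?_
  rcases (h0 s).eq_or_lt with h | h
  · simp [← h]
  have := mul_le_mul_of_nonneg_left (Real.one_sub_inv_le_log_of_pos (hr s h)) h.le
  calc T s - T s / r s = T s * (1 - (r s)⁻¹) := by ring
    _ ≤ _ := this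

/-- Dividing `T` by the ratio leaves at most the law under which x and (w, v) are conditionally
independent given y, so Gibbs' inequality applies. -/
theorem sum_mul_logb_condRatio_nonneg (h0 : ∀ s, 0 ≤ T s) (h1 : ∑ s, T s = 1) :
    0 ≤ ∑ s, T s * Real.logb 2 (condRatio T s) := by
  refine sum_mul_logb_nonneg h0 h1 (fun s => condRatio_pos h0) ?_
  have : ∀ s, T s / condRatio T s ≤
      margXY T s.1 s.2.1 * margYWV T s.2.1 s.2.2.1 s.2.2.2 / margY T s.2.1 := by
    intro s
    rcases (h0 s).eq_or_lt with h | h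
    · rw [← h, zero_div]
      exact div_nonneg (mul_nonneg (margXY_nonneg h0 _ _) (margYWV_nonneg h0 _ _ _))
        (margY_nonneg h0 _)
    · rw [condRatio, div_div_eq_mul_div, mul_div_mul_left _ _ h.ne']
  refine (Finset.sum_le_sum fun s _ => this s).trans ?_
  rw [← h1, ← sum_margY T]
  simp only [Fintype.sum_prod_type]
  rw [Finset.sum_comm]
  refine Finset.sum_le_sum fun y _ => ?_
  simp only [← Finset.sum_div, ← Finset.mul_sum, sum_margYWV, ← Finset.sum_mul]
  rw [show ∑ x, margXY T x y = margY T y from rfl]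
  exact (mul_self_div_self _).le

/-- Here the comparison law is the product of the marginals of (x, y) and v. -/
theorem sum_mul_logb_pairRatio_nonneg (h0 : ∀ s, 0 ≤ T s) (h1 : ∑ s, T s = 1) :
    0 ≤ ∑ s, T s * Real.logb 2 (pairRatio T s) := by
  refine sum_mul_logb_nonneg h0 h1 (fun s => pairRatio_pos h0) ?_
  have : ∑ s : X × Y × W × V, T s / pairRatio T s ≤
      ∑ x, ∑ y, ∑ v, margXY T x y * margV T v := by
    simp only [Fintype.sum_prod_type]
    refine Finset.sum_le_sum fun x _ => Finset.sum_le_sum fun y _ => ?_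
    rw [Finset.sum_comm]
    refine Finset.sum_le_sum fun v _ => ?_
    simp only [pairRatio, ← Finset.sum_div]
    rw [show ∑ w, T (x, y, w, v) = margXYV T x y v from rfl, div_div_eq_mul_div, mul_comm,
      mul_div_assoc]
    exact mul_le_of_le_one_right (mul_nonneg (margXY_nonneg h0 _ _) (margV_nonneg h0 _))
      (div_self_le_one _)
  refine this.trans ?_
  simp only [← Finset.mul_sum, sum_margV, h1, mul_one, sum_margXY]
  exact le_rfl

theorem sum_seq_prod_type {n : ℕ} {A B : Type*} [Fintype A] [Fintype B]
    (g : (Fin n → A × B) → ℝ) :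
    ∑ s, g s = ∑ a : Fin n → A, ∑ b : Fin n → B, g fun i => (a i, b i) := by
  rw [← (Equiv.arrowProdEquivProdArrow (Fin n) (fun _ => A) fun _ => B).symm.sum_comp,
    Fintype.sum_prod_type]
  rfl

theorem sum_prod_seq₂ {n : ℕ} {A B : Type*} [Fintype A] [Fintype B] (f : Fin n → A → B → ℝ) :
    ∑ a : Fin n → A, ∑ b : Fin n → B, ∏ i, f i (a i) (b i) = ∏ i, ∑ a, ∑ b, f i a b := by
  simp_rw [fun a : Fin n → A => sum_prod_seq fun i b => f i (a i) b,
    sum_prod_seq fun i a => ∑ b, f i a b]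

end Marginals

/-! ### Products of ratios along typical sequences; message counts -/

section Typical

variable {S : Type*} [Fintype S] {n : ℕ}

omit [Fintype S] in
theorem prod_eq_rpow_sum_logb (r : S → ℝ) (s : Fin n → S) (hr : ∀ i, 0 < r (s i)) :
    ∏ i, r (s i) = (2 : ℝ) ^ (∑ i, Real.logb 2 (r (s i))) := by
  rw [Real.rpow_sum_of_pos two_pos]
  exact Finset.prod_congr rfl fun i _ =>
    (Real.rpow_logb two_pos (by norm_num) (hr i)).symm

theorem prod_mem_Icc_of_typical (T r : S → ℝ) (s : Fin n → S) (hr : ∀ i, 0 < r (s i)) {C δ : ℝ}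
    (hC : ∀ a, |Real.logb 2 (r a)| ≤ C) (hs : 2 * C * tvDist (empiricalDist s) T ≤ δ) :
    ∏ i, r (s i) ∈ Set.Icc ((2 : ℝ) ^ (n * (∑ a, T a * Real.logb 2 (r a) - δ)))
      ((2 : ℝ) ^ (n * (∑ a, T a * Real.logb 2 (r a) + δ))) := by
  have h := abs_le.1 ((abs_sum_sub_le_tvDist s T (fun a => Real.logb 2 (r a)) hC).trans
    (mul_le_mul_of_nonneg_left hs (Nat.cast_nonneg n)))
  rw [prod_eq_rpow_sum_logb r s hr]
  constructor <;> refine Real.rpow_le_rpow_of_exponent_le one_le_two ?_ <;>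
    linarith [h.1, h.2]
end Typical

/-- At a nonnegative rate the floor is taken of a number at least 1, so it loses at most a factor 2.
-/
theorem half_rpow_le_numMessages (n : ℕ) {R : ℝ} (hR : 0 ≤ R) :
    (2 : ℝ) ^ (n * R) / 2 ≤ numMessages n R := by
  have h1 : (1 : ℝ) ≤ (2 : ℝ) ^ (n * R) := Real.one_le_rpow one_le_two (by positivity)
  have h2 : 1 ≤ numMessages n R := (Nat.one_le_floor_iff _).2 h1
  have h3 : (1 : ℝ) ≤ numMessages n R := by exact_mod_cast h2
  have h4 := (Nat.lt_floor_add_one ((2 : ℝ) ^ (n * R))).le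
  change _ ≤ (numMessages n R : ℝ) + 1 at h4
  linarith

theorem numMessages_pos (n : ℕ) {R : ℝ} (hR : 0 ≤ R) : 0 < numMessages n R :=
  (Nat.one_le_floor_iff _).2 (Real.one_le_rpow one_le_two (by positivity))

/-! ### Achievability -/

section Direct

variable {X Y X₁ X₂ : Type*} [Fintype X] [Fintype Y] [Fintype X₁] [Fintype X₂]

theorem targetDist_nonneg (P₀ : stdSimplex ℝ (X × Y)) (Q : X × Y → stdSimplex ℝ (X₁ × X₂))
    (s : X × Y × X₁ × X₂) : 0 ≤ targetDist P₀ Q s :=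
  mul_nonneg (P₀.2.1 _) ((Q _).2.1 _)

theorem margXY_targetDist (P₀ : stdSimplex ℝ (X × Y)) (Q : X × Y → stdSimplex ℝ (X₁ × X₂))
    (x : X) (y : Y) : margXY (targetDist P₀ Q) x y = P₀ (x, y) := by
  have h := (Q (x, y)).2.2
  rw [Fintype.sum_prod_type] at h
  simp only [margXY, targetDist, ← Finset.mul_sum]
  exact (congrArg (P₀ (x, y) * ·) h).trans (mul_one _)

theorem sum_targetDist (P₀ : stdSimplex ℝ (X × Y)) (Q : X × Y → stdSimplex ℝ (X₁ × X₂)) :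
    ∑ s, targetDist P₀ Q s = 1 := by
  rw [← sum_margXY]
  simp only [margXY_targetDist]
  rw [← Fintype.sum_prod_type (f := fun a : X × Y => (P₀ a : ℝ))]
  exact P₀.2.2

theorem nonempty_of_targetDist (P₀ : stdSimplex ℝ (X × Y))
    (Q : X × Y → stdSimplex ℝ (X₁ × X₂)) : Nonempty (X × Y × X₁ × X₂) := by
  by_contra hc
  rw [not_nonempty_iff] at hc
  simpa using sum_targetDist P₀ Q

-- Requiring positive mass of every letter costs nothing: a sequence with a letter of mass zero has
-- probability zero.
open Classical in
theorem sum_not_typical_eq {n : ℕ} (T : X × Y × X₁ × X₂ → ℝ) (h0 : ∀ s, 0 ≤ T s) (ε : ℝ)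
    (F : (Fin n → X) → (Fin n → Y) → (Fin n → X₁) → (Fin n → X₂) → Prop)
    (hF : ∀ x y w v, F x y w v ↔ tvDist (empiricalDist fun i => (x i, y i, w i, v i)) T ≤ ε ∧
        ∀ i, 0 < T (x i, y i, w i, v i)) :
    ∑ x, ∑ y, ∑ w, ∑ v, (if F x y w v then 0 else ∏ i, T (x i, y i, w i, v i)) =
      ∑ s : Fin n → X × Y × X₁ × X₂,
        if ε < tvDist (empiricalDist s) T then ∏ i, T (s i) else 0 := by
  simp_rw [sum_seq_prod_type]
  refine Finset.sum_congr rfl fun x _ => Finset.sum_congr rfl fun y _ =>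
    Finset.sum_congr rfl fun w _ => Finset.sum_congr rfl fun v _ => ?_
  by_cases h : tvDist (empiricalDist fun i => (x i, y i, w i, v i)) T ≤ ε
  · rw [if_neg (not_lt.2 h)]
    by_cases h' : ∀ i, 0 < T (x i, y i, w i, v i)
    · rw [if_pos ((hF _ _ _ _).2 ⟨h, h'⟩)]
    · rw [if_neg fun hc => h' ((hF _ _ _ _).1 hc).2]
      push Not at h'
      obtain ⟨i, hi⟩ := h'
      exact Finset.prod_eq_zero (Finset.mem_univ i) (le_antisymm hi (h0 _))
  · rw [if_neg fun hc => h ((hF _ _ _ _).1 hc).1, if_pos (not_le.1 h)]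

open Classical in
/-- The cascade code read off from a codebook and lists has error probability at most the
probability that no list entry is good. -/
theorem exists_code_errorProb_le {n M₁ M₂ : ℕ} (hM₁ : 0 < M₁) (P₀ : stdSimplex ℝ (X × Y))
    (T : X × Y × X₁ × X₂ → ℝ) (ε : ℝ)
    (F : (Fin n → X) → (Fin n → Y) → (Fin n → X₁) → (Fin n → X₂) → Prop)
    (hF : ∀ x y w v, F x y w v → tvDist (empiricalDist fun i => (x i, y i, w i, v i)) T ≤ ε)
    (c : Fin M₂ → Fin n → X₂) (φ : (Fin n → Y) → Fin M₁ → Fin M₂ × (Fin n → X₁)) :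
    ∃ C : CascadeCode X Y X₁ X₂ n M₁ M₂, C.errorProb P₀ T ε ≤
      ∑ x : Fin n → X, ∑ y : Fin n → Y,
        (if ∃ m, F x y (φ y m).2 (c (φ y m).1) then 0 else ∏ i, P₀ (x i, y i)) := by
  -- When no list entry is good, message 0 is sent; that case is already counted as an error.
  refine ⟨⟨fun x y => if h : ∃ m, F x y (φ y m).2 (c (φ y m).1) then h.choose else ⟨0, hM₁⟩,
    fun y m => (φ y m).1, fun y m => (φ y m).2, c⟩, ?_⟩
  refine Finset.sum_le_sum fun x _ => Finset.sum_le_sum fun y _ => ?_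
  have hp : 0 ≤ ∏ i, P₀ (x i, y i) := Finset.prod_nonneg fun i _ => P₀.2.1 _
  by_cases h : ∃ m, F x y (φ y m).2 (c (φ y m).1)
  · have h' := hF _ _ _ _ h.choose_spec
    rw [if_pos h, if_neg]
    rw [not_lt]
    unfold CascadeCode.output
    simp only [dif_pos h]
    exact h'
  · rw [if_neg h]
    split_ifs
    exacts [le_rfl, hp]

theorem prod_margXYV_le {n : ℕ} {T : X × Y × X₁ × X₂ → ℝ} (h0 : ∀ s, 0 ≤ T s)
    {s : Fin n → X × Y × X₁ × X₂} (hs : ∀ i, 0 < T (s i)) {A : ℝ}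
    (hA : ∏ i, pairRatio T (s i) ≤ A) :
    ∏ i, margXYV T (s i).1 (s i).2.1 (s i).2.2.2 ≤
      A * ((∏ i, margXY T (s i).1 (s i).2.1) * ∏ i, margV T (s i).2.2.2) := by
  simp only [pairRatio, Finset.prod_div_distrib, Finset.prod_mul_distrib] at hA
  rwa [div_le_iff₀ (mul_pos (Finset.prod_pos fun i _ => margXY_pos h0 (hs i))
    (Finset.prod_pos fun i _ => margV_pos h0 (hs i)))] at hA

/-- The quotient `pairRatio`/`condRatio` equals P(y,w,v)P(x,y,v) / (P(y)P(v)P(x,y,w,v)). Bounding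
its numerator below and its denominator above yields the hypothesis on B in the covering lemma. -/
theorem mul_prod_le_prod_margYWV {n : ℕ} {T : X × Y × X₁ × X₂ → ℝ} (h0 : ∀ s, 0 ≤ T s)
    {s : Fin n → X × Y × X₁ × X₂} (hs : ∀ i, 0 < T (s i)) {B D : ℝ} (hB : 0 ≤ B)
    (hBD : B * D ≤ ∏ i, pairRatio T (s i)) (hD : ∏ i, condRatio T (s i) ≤ D) :
    B * ((∏ i, margY T (s i).2.1) * (∏ i, margV T (s i).2.2.2) * ∏ i, T (s i)) ≤
      (∏ i, margYWV T (s i).2.1 (s i).2.2.1 (s i).2.2.2) *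
        ∏ i, margXYV T (s i).1 (s i).2.1 (s i).2.2.2 := by
  simp only [pairRatio, condRatio, Finset.prod_div_distrib, Finset.prod_mul_distrib] at hBD hD
  have p1 : 0 < ∏ i, margXY T (s i).1 (s i).2.1 :=
    Finset.prod_pos fun i _ => margXY_pos h0 (hs i)
  have p2 : 0 < ∏ i, margV T (s i).2.2.2 := Finset.prod_pos fun i _ => margV_pos h0 (hs i)
  have p3 : 0 < ∏ i, margYWV T (s i).2.1 (s i).2.2.1 (s i).2.2.2 :=
    Finset.prod_pos fun i _ => margYWV_pos h0 (hs i)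
  rw [le_div_iff₀ (mul_pos p1 p2)] at hBD
  rw [div_le_iff₀ (mul_pos p1 p3)] at hD
  generalize (∏ i, margXY T (s i).1 (s i).2.1) = a1 at *
  generalize (∏ i, margV T (s i).2.2.2) = a2 at *
  generalize (∏ i, margYWV T (s i).2.1 (s i).2.2.1 (s i).2.2.2) = a3 at *
  generalize (∏ i, margY T (s i).2.1) = a4 at *
  generalize (∏ i, T (s i)) = a5 at *
  generalize (∏ i, margXYV T (s i).1 (s i).2.1 (s i).2.2.2) = a6 at *
  calc B * (a4 * a2 * a5) = B * a2 * (a5 * a4) := by ring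
    _ ≤ B * a2 * (D * (a1 * a3)) := mul_le_mul_of_nonneg_left hD (by positivity)
    _ = a3 * (B * D * (a1 * a2)) := by ring
    _ ≤ a3 * a6 := mul_le_mul_of_nonneg_left hBD p3.le

theorem rpow_div_numMessages_le (n : ℕ) {R a b : ℝ} (hR : 0 ≤ R) (h : a + b ≤ R) :
    (2 : ℝ) ^ (n * a) / numMessages n R ≤ 2 * (2 : ℝ) ^ (-(n * b)) := by
  rw [div_le_iff₀ (by exact_mod_cast numMessages_pos n hR)]
  refine le_trans ?_ (mul_le_mul_of_nonneg_left (half_rpow_le_numMessages n hR)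
    (by positivity))
  rw [show 2 * (2 : ℝ) ^ (-(n * b)) * ((2 : ℝ) ^ (n * R) / 2) =
    (2 : ℝ) ^ (-(n * b)) * (2 : ℝ) ^ (n * R) by ring, ← Real.rpow_add two_pos]
  refine Real.rpow_le_rpow_of_exponent_le one_le_two ?_
  have := mul_le_mul_of_nonneg_left h (Nat.cast_nonneg (α := ℝ) n)
  linarith

open Classical in
/-- Random coding bound for the cascade network at blocklength `n`. -/
theorem exists_code_errorProb_le_exponent (P₀ : stdSimplex ℝ (X × Y)) {T : X × Y × X₁ × X₂ → ℝ}
    (h0 : ∀ s, 0 ≤ T s) (h1 : ∑ s, T s = 1) (hp : ∀ x y, margXY T x y = P₀ (x, y))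
    {I₁ I₂ R₁ R₂ δ ε : ℝ} [Nonempty X₁]
    (hI₁ : I₁ = ∑ s, T s * Real.logb 2 (condRatio T s))
    (hI₂ : I₂ = ∑ s, T s * Real.logb 2 (pairRatio T s))
    (hδ : 0 < δ) (hR₁ : I₁ + 5 * δ ≤ R₁) (hR₂ : I₂ + 2 * δ ≤ R₂) {C : ℝ} (hC0 : 0 ≤ C)
    (hC₁ : ∀ s, |Real.logb 2 (condRatio T s)| ≤ C)
    (hC₂ : ∀ s, |Real.logb 2 (pairRatio T s)| ≤ C)
    (hε : 2 * C * ε ≤ δ) (n : ℕ) :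
    ∃ K : CascadeCode X Y X₁ X₂ n (numMessages n R₁) (numMessages n R₂),
      K.errorProb P₀ T ε ≤ 5 * (2 : ℝ) ^ (-(n * δ)) +
        ∑ s : Fin n → X × Y × X₁ × X₂,
          if ε < tvDist (empiricalDist s) T then ∏ i, T (s i) else 0 := by
  have hR₁0 : 0 ≤ R₁ := by
    have := sum_mul_logb_condRatio_nonneg h0 h1
    linarith
  have hR₂0 : 0 ≤ R₂ := by
    have := sum_mul_logb_pairRatio_nonneg h0 h1
    linarith
  obtain ⟨F, hF⟩ : ∃ F : (Fin n → X) → (Fin n → Y) → (Fin n → X₁) → (Fin n → X₂) → Prop,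
      ∀ x y w v, F x y w v ↔ tvDist (empiricalDist fun i => (x i, y i, w i, v i)) T ≤ ε ∧
        ∀ i, 0 < T (x i, y i, w i, v i) := ⟨_, fun _ _ _ _ => Iff.rfl⟩
  have hFpos : ∀ x y w v, F x y w v → ∀ i, 0 < T (x i, y i, w i, v i) :=
    fun x y w v hf => ((hF x y w v).1 hf).2
  have hFpair : ∀ x y w v, F x y w v → ∏ i, pairRatio T (x i, y i, w i, v i) ∈
      Set.Icc ((2 : ℝ) ^ (n * (I₂ - δ))) ((2 : ℝ) ^ (n * (I₂ + δ))) := by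
    intro x y w v hf
    obtain ⟨hf, hpos⟩ := (hF x y w v).1 hf
    rw [hI₂]
    exact prod_mem_Icc_of_typical T (pairRatio T) (fun i => (x i, y i, w i, v i))
      (fun i => pairRatio_pos h0 (hpos i)) hC₂
      ((mul_le_mul_of_nonneg_left hf (by positivity)).trans hε)
  have hFcond : ∀ x y w v, F x y w v → ∏ i, condRatio T (x i, y i, w i, v i) ∈
      Set.Icc ((2 : ℝ) ^ (n * (I₁ - δ))) ((2 : ℝ) ^ (n * (I₁ + δ))) := by
    intro x y w v hf
    obtain ⟨hf, hpos⟩ := (hF x y w v).1 hf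
    rw [hI₁]
    exact prod_mem_Icc_of_typical T (condRatio T) (fun i => (x i, y i, w i, v i))
      (fun i => condRatio_pos h0 (hpos i)) hC₁
      ((mul_le_mul_of_nonneg_left hf (by positivity)).trans hε)
  -- The parameters of the covering lemma: A is the upper bound for `pairRatio`, B the lower bound
  -- I₂ - δ for its exponent minus the upper bound I₁ + δ for that of `condRatio`, and z = 2^{nδ}.
  have hA : 0 < (2 : ℝ) ^ (n * (I₂ + δ)) := by positivity
  have hB : 0 < (2 : ℝ) ^ (n * (I₂ - I₁ - 2 * δ)) := by positivity
  have hz : 0 < (2 : ℝ) ^ (n * δ) := by positivity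
  have hBD : (2 : ℝ) ^ (n * (I₂ - I₁ - 2 * δ)) * (2 : ℝ) ^ (n * (I₁ + δ)) =
      (2 : ℝ) ^ (n * (I₂ - δ)) := by
    rw [← Real.rpow_add two_pos]; ring_nf
  have s1 : ∀ (x : Fin n → X) (y : Fin n → Y) (v : Fin n → X₂),
      ∑ w : Fin n → X₁, ∏ i, T (x i, y i, w i, v i) = ∏ i, margXYV T (x i) (y i) (v i) :=
    fun x y v => sum_prod_seq fun i w => T (x i, y i, w, v i)
  have s2 : ∀ (x : Fin n → X) (y : Fin n → Y),
      ∑ v : Fin n → X₂, ∏ i, margXYV T (x i) (y i) (v i) = ∏ i, margXY T (x i) (y i) := by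
    intro x y
    rw [sum_prod_seq fun i v => margXYV T (x i) (y i) v]
    simp only [sum_margXYV]
  have s3 : ∀ v : Fin n → X₂, ∑ y : Fin n → Y, ∑ w : Fin n → X₁,
      ∏ i, margYWV T (y i) (w i) (v i) = ∏ i, margV T (v i) :=
    fun v => sum_prod_seq₂ fun i y w => margYWV T y w (v i)
  have s4 : ∀ y : Fin n → Y, ∑ x : Fin n → X, ∏ i, margXY T (x i) (y i) = ∏ i, margY T (y i) :=
    fun y => sum_prod_seq fun i x => margXY T x (y i)
  have s5 : ∑ v : Fin n → X₂, ∏ i, margV T (v i) = 1 := by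
    rw [sum_prod_seq fun _ v => margV T v]; simp [sum_margV, h1]
  have s6 : ∑ x : Fin n → X, ∑ y : Fin n → Y, ∏ i, margXY T (x i) (y i) = 1 := by
    rw [sum_prod_seq₂ fun _ x y => margXY T x y]; simp [sum_margXY, h1]
  have f1 : ∀ x y w v, F x y w v → 0 < ∏ i, margV T (v i) := fun x y w v hf =>
    Finset.prod_pos fun i _ => margV_pos (s := (x i, y i, w i, v i)) h0 (hFpos x y w v hf i)
  have f2 : ∀ x y w v, F x y w v → 0 < ∏ i, margXYV T (x i) (y i) (v i) ∧
      ∏ i, margXYV T (x i) (y i) (v i) ≤ (2 : ℝ) ^ (n * (I₂ + δ)) *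
        ((∏ i, margXY T (x i) (y i)) * ∏ i, margV T (v i)) := fun x y w v hf =>
    ⟨Finset.prod_pos fun i _ => margXYV_pos (s := (x i, y i, w i, v i)) h0 (hFpos x y w v hf i),
      prod_margXYV_le (s := fun i => (x i, y i, w i, v i)) h0 (hFpos x y w v hf)
        (hFpair x y w v hf).2⟩
  have f3 : ∀ x y w v, F x y w v → (2 : ℝ) ^ (n * (I₂ - I₁ - 2 * δ)) *
      ((∏ i, margY T (y i)) * (∏ i, margV T (v i)) * ∏ i, T (x i, y i, w i, v i)) ≤
      (∏ i, margYWV T (y i) (w i) (v i)) * ∏ i, margXYV T (x i) (y i) (v i) := by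
    intro x y w v hf
    have e1 := hBD.le.trans (hFpair x y w v hf).1
    have e2 := (hFcond x y w v hf).2
    exact mul_prod_le_prod_margYWV (s := fun i => (x i, y i, w i, v i)) h0
      (hFpos x y w v hf) hB.le e1 e2
  have n1 : ∀ (x : Fin n → X) (y : Fin n → Y) (w : Fin n → X₁) (v : Fin n → X₂),
      0 ≤ ∏ i, T (x i, y i, w i, v i) := fun x y w v => Finset.prod_nonneg fun i _ => h0 _
  have n2 : ∀ (y : Fin n → Y) (w : Fin n → X₁) (v : Fin n → X₂),
      0 ≤ ∏ i, margYWV T (y i) (w i) (v i) :=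
    fun y w v => Finset.prod_nonneg fun i _ => margYWV_nonneg h0 _ _ _
  have n3 : ∀ v : Fin n → X₂, 0 ≤ ∏ i, margV T (v i) :=
    fun v => Finset.prod_nonneg fun i _ => margV_nonneg h0 _
  obtain ⟨c, φ, hcφ⟩ := exists_cascade_covering _ _ _ _ _ _ F n1 n2 n3 s1 s2 s3 s4 s5 s6 f1 hA hB
    hz f2 f3 (numMessages_pos n hR₁0) (numMessages_pos n hR₂0)
  obtain ⟨K, hK⟩ := exists_code_errorProb_le (numMessages_pos n hR₁0) P₀ T ε F
    (fun x y w v hf => ((hF x y w v).1 hf).1) c φ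
  refine ⟨K, hK.trans ?_⟩
  simp only [← hp]
  refine hcφ.trans ?_
  have hsum := sum_not_typical_eq (n := n) T h0 ε F hF
  have b1 : 1 / (2 : ℝ) ^ (n * δ) = (2 : ℝ) ^ (-(n * δ)) := by
    rw [Real.rpow_neg two_pos.le, one_div]
  have b2 := rpow_div_numMessages_le n (a := I₂ + δ) (b := δ) hR₂0 (by linarith)
  -- Az/(M₁B) equals 2^{n(I₁+4δ)}/M₁, hence the margin 5δ in the first rate. The three error terms
  -- contribute 1 + 2 + 2 = 5.
  have b3 : (2 : ℝ) ^ (n * (I₂ + δ)) * (2 : ℝ) ^ (n * δ) /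
      (numMessages n R₁ * (2 : ℝ) ^ (n * (I₂ - I₁ - 2 * δ))) ≤ 2 * (2 : ℝ) ^ (-(n * δ)) := by
    refine le_trans (le_of_eq ?_)
      (rpow_div_numMessages_le n (a := I₁ + 4 * δ) (b := δ) hR₁0 (by linarith))
    rw [mul_comm (numMessages n R₁ : ℝ), ← div_div, ← Real.rpow_add two_pos,
      ← Real.rpow_sub two_pos]
    ring_nf
  rw [b1]
  have hsum' := hsum.le
  linarith

/-- By the triangle inequality, a change of target is absorbed by the tolerance. This serves the
diagonal argument (same target) and the converse (perturbed target). -/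
theorem errorProb_anti {n M₁ M₂ : ℕ} (C : CascadeCode X Y X₁ X₂ n M₁ M₂)
    (P₀ : stdSimplex ℝ (X × Y)) {T T' : X × Y × X₁ × X₂ → ℝ} {ε ε' : ℝ}
    (h : ε + tvDist T T' ≤ ε') : C.errorProb P₀ T' ε' ≤ C.errorProb P₀ T ε := by
  classical
  refine Finset.sum_le_sum fun x _ => Finset.sum_le_sum fun y _ => ?_
  have hp : 0 ≤ ∏ i, P₀ (x i, y i) := Finset.prod_nonneg fun i _ => P₀.2.1 _
  split_ifs with h1 h2
  · exact le_rfl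
  · exact absurd (by linarith [tvDist_triangle (empiricalDist (C.output x y)) T T']) h2
  · exact hp
  · exact le_rfl

theorem tvDist_self {S : Type*} [Fintype S] (p : S → ℝ) : tvDist p p = 0 := by simp [tvDist]

theorem errorProb_nonneg {n M₁ M₂ : ℕ} (C : CascadeCode X Y X₁ X₂ n M₁ M₂)
    (P₀ : stdSimplex ℝ (X × Y)) (T : X × Y × X₁ × X₂ → ℝ) (ε : ℝ) : 0 ≤ C.errorProb P₀ T ε :=
  Finset.sum_nonneg fun x _ => Finset.sum_nonneg fun y _ => by
    split_ifs
    exacts [Finset.prod_nonneg fun i _ => P₀.2.1 _, le_rfl]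

theorem exists_abs_le {S : Type*} [Fintype S] (f : S → ℝ) : ∃ C, 0 ≤ C ∧ ∀ s, |f s| ≤ C :=
  ⟨∑ s, |f s|, Finset.sum_nonneg fun _ _ => abs_nonneg _, fun s =>
    Finset.single_le_sum (f := fun s => |f s|) (fun _ _ => abs_nonneg _) (Finset.mem_univ s)⟩

/-- Strictly inside the information region, good codes exist at all large blocklengths. -/
theorem eventually_exists_code (P₀ : stdSimplex ℝ (X × Y)) (Q : X × Y → stdSimplex ℝ (X₁ × X₂))
    {R₁ R₂ ε : ℝ} [Nonempty X₁]
    (hR₁ : ∑ s, targetDist P₀ Q s * Real.logb 2 (condRatio (targetDist P₀ Q) s) < R₁)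
    (hR₂ : ∑ s, targetDist P₀ Q s * Real.logb 2 (pairRatio (targetDist P₀ Q) s) < R₂)
    (hε : 0 < ε) :
    ∀ᶠ n in atTop, ∃ K : CascadeCode X Y X₁ X₂ n (numMessages n R₁) (numMessages n R₂),
      K.errorProb P₀ (targetDist P₀ Q) ε ≤ ε := by
  obtain ⟨C₁, hC₁0, hC₁⟩ :=
    exists_abs_le fun s => Real.logb 2 (condRatio (targetDist P₀ Q) s)
  obtain ⟨C₂, hC₂0, hC₂⟩ :=
    exists_abs_le fun s => Real.logb 2 (pairRatio (targetDist P₀ Q) s)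
  set I₁ := ∑ s, targetDist P₀ Q s * Real.logb 2 (condRatio (targetDist P₀ Q) s) with hI₁
  set I₂ := ∑ s, targetDist P₀ Q s * Real.logb 2 (pairRatio (targetDist P₀ Q) s) with hI₂
  obtain ⟨δ, hδ, hδ₁, hδ₂⟩ : ∃ δ > 0, I₁ + 5 * δ ≤ R₁ ∧ I₂ + 2 * δ ≤ R₂ := by
    refine ⟨min ((R₁ - I₁) / 5) ((R₂ - I₂) / 2),
      lt_min (by linarith) (by linarith), ?_, ?_⟩
    · linarith [min_le_left ((R₁ - I₁) / 5) ((R₂ - I₂) / 2)]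
    · linarith [min_le_right ((R₁ - I₁) / 5) ((R₂ - I₂) / 2)]
  set C := C₁ + C₂
  have hC0 : 0 ≤ C := add_nonneg hC₁0 hC₂0
  -- The 1 in the denominator covers C = 0.
  set ε' := min ε (δ / (2 * C + 1)) with hε'
  have hε'0 : 0 < ε' := lt_min hε (by positivity)
  have hCε : 2 * C * ε' ≤ δ := by
    have : ε' * (2 * C + 1) ≤ δ := (le_div_iff₀ (by positivity)).1 (min_le_right _ _)
    linarith
  have hlim : Tendsto (fun n : ℕ => 5 * (2 : ℝ) ^ (-(n * δ))) atTop (𝓝 0) := by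
    have h := tendsto_pow_atTop_nhds_zero_of_lt_one (r := (2 : ℝ) ^ (-δ)) (by positivity)
      (Real.rpow_lt_one_of_one_lt_of_neg one_lt_two (by linarith))
    have h' := h.const_mul 5
    rw [mul_zero] at h'
    refine h'.congr fun n => ?_
    rw [← Real.rpow_natCast, ← Real.rpow_mul two_pos.le]
    ring_nf
  have hlim' := hlim.add (tendsto_sum_not_typical (targetDist P₀ Q) (targetDist_nonneg P₀ Q)
    (sum_targetDist P₀ Q) hε'0)
  rw [add_zero] at hlim'
  filter_upwards [hlim'.eventually (ge_mem_nhds hε)] with n hn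
  obtain ⟨K, hK⟩ := exists_code_errorProb_le_exponent P₀ (targetDist_nonneg P₀ Q)
    (sum_targetDist P₀ Q) (margXY_targetDist P₀ Q) hI₁ hI₂ hδ hδ₁ hδ₂ hC0
    (fun s => (hC₁ s).trans (by simp [C, hC₂0])) (fun s => (hC₂ s).trans (by simp [C, hC₁0]))
    hCε n
  refine ⟨K, (errorProb_anti K P₀ ?_).trans (hK.trans hn)⟩
  rw [tvDist_self, add_zero]
  exact min_le_left _ _

/-- Diagonalization over the tolerance. -/
theorem achievable_of_eventually_exists (P₀ : stdSimplex ℝ (X × Y))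
    (Q : X × Y → stdSimplex ℝ (X₁ × X₂)) {R : ℝ × ℝ}
    (hne : ∀ n, Nonempty (CascadeCode X Y X₁ X₂ n (numMessages n R.1) (numMessages n R.2)))
    (h : ∀ ε > 0, ∀ᶠ n in atTop,
      ∃ K : CascadeCode X Y X₁ X₂ n (numMessages n R.1) (numMessages n R.2),
        K.errorProb P₀ (targetDist P₀ Q) ε ≤ ε) : Achievable P₀ Q R := by
  classical
  let G : ℕ → ℕ → Prop := fun n k =>
    ∃ K : CascadeCode X Y X₁ X₂ n (numMessages n R.1) (numMessages n R.2),
      K.errorProb P₀ (targetDist P₀ Q) (1 / (k + 1)) ≤ 1 / (k + 1)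
  -- At blocklength n, take a code for the largest k ≤ n whose tolerance 1/(k+1) is attainable. The
  -- premise is needed because `Nat.findGreatest` defaults to 0 when there is none.
  have hex : ∀ n, ∃ K : CascadeCode X Y X₁ X₂ n (numMessages n R.1) (numMessages n R.2),
      (∃ k ≤ n, G n k) → K.errorProb P₀ (targetDist P₀ Q) (1 / (Nat.findGreatest (G n) n + 1)) ≤
        1 / (Nat.findGreatest (G n) n + 1) := by
    intro n
    by_cases hk : ∃ k ≤ n, G n k
    · obtain ⟨k, hkn, hk'⟩ := hk
      obtain ⟨K, hK⟩ := Nat.findGreatest_spec hkn hk'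
      exact ⟨K, fun _ => hK⟩
    · exact ⟨(hne n).some, fun hc => absurd hc hk⟩
  choose K hK using hex
  refine ⟨K, fun ε hε => ?_⟩
  rw [Metric.tendsto_atTop]
  intro η hη
  obtain ⟨k, hk⟩ := exists_nat_one_div_lt (lt_min hε hη)
  obtain ⟨N, hN⟩ := eventually_atTop.1 (h (1 / (k + 1)) (by positivity))
  refine ⟨max N k, fun n hn => ?_⟩
  have hkn : k ≤ n := (le_max_right _ _).trans hn
  have hG : G n k := hN n ((le_max_left _ _).trans hn)
  have h1 := hK n ⟨k, hkn, hG⟩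
  have h2 : k ≤ Nat.findGreatest (G n) n := Nat.le_findGreatest hkn hG
  have h3 : (1 : ℝ) / (Nat.findGreatest (G n) n + 1) ≤ 1 / (k + 1) :=
    one_div_le_one_div_of_le (by positivity) (by exact_mod_cast Nat.succ_le_succ h2)
  rw [Real.dist_0_eq_abs, abs_of_nonneg (errorProb_nonneg _ _ _ _)]
  calc (K n).errorProb P₀ (targetDist P₀ Q) ε ≤ _ := errorProb_anti _ P₀ (by
        rw [tvDist_self, add_zero]
        exact h3.trans (hk.le.trans (min_le_left _ _)))
    _ ≤ _ := h1
    _ ≤ _ := h3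
    _ < η := hk.trans_le (min_le_right _ _)

theorem achievable_of_lt (P₀ : stdSimplex ℝ (X × Y)) (Q : X × Y → stdSimplex ℝ (X₁ × X₂))
    {R : ℝ × ℝ}
    (hR₁ : ∑ s, targetDist P₀ Q s * Real.logb 2 (condRatio (targetDist P₀ Q) s) < R.1)
    (hR₂ : ∑ s, targetDist P₀ Q s * Real.logb 2 (pairRatio (targetDist P₀ Q) s) < R.2) :
    Achievable P₀ Q R := by
  have h0 := targetDist_nonneg P₀ Q
  have h1 := sum_targetDist P₀ Q
  obtain ⟨s⟩ := nonempty_of_targetDist P₀ Q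
  have : Nonempty X₁ := ⟨s.2.2.1⟩
  -- Nonnegative information forces nonnegative rates, so message sets are nonempty and a code
  -- exists at every blocklength.
  have p1 : 0 ≤ R.1 := (sum_mul_logb_condRatio_nonneg h0 h1).trans hR₁.le
  have p2 : 0 ≤ R.2 := (sum_mul_logb_pairRatio_nonneg h0 h1).trans hR₂.le
  exact achievable_of_eventually_exists P₀ Q
    (fun n => ⟨⟨fun _ _ => ⟨0, numMessages_pos n p1⟩, fun _ _ => ⟨0, numMessages_pos n p2⟩,
      fun _ _ _ => s.2.2.1, fun _ _ => s.2.2.2⟩⟩)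
    fun ε hε => eventually_exists_code P₀ Q hR₁ hR₂ hε

end Direct

/-! ### Converse by change of measure -/

section Converse

theorem numMessages_le (n : ℕ) (R : ℝ) : (numMessages n R : ℝ) ≤ ((2 : ℝ) ^ R) ^ n := by
  rw [← Real.rpow_natCast, ← Real.rpow_mul two_pos.le, mul_comm]
  exact Nat.floor_le (by positivity)

/-- Otherwise (2^R (1+η)/2^c)^n tends to 0 and eventually falls below the constant 1/2. -/
theorem sub_logb_le_of_eventually {R c η : ℝ} (hη : 0 < η)
    (h : ∀ᶠ n : ℕ in atTop,
      1 / 2 * (2 : ℝ) ^ (n * c) ≤ numMessages n R * (1 + η) ^ n) :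
    c - Real.logb 2 (1 + η) ≤ R := by
  by_contra! hc
  set q : ℝ := (2 : ℝ) ^ R * (1 + η) / (2 : ℝ) ^ c with hq
  have hq0 : 0 < q := by positivity
  have hq1 : q < 1 := by
    rw [hq, div_lt_one (by positivity)]
    nth_rewrite 1 [← Real.rpow_logb two_pos (by norm_num) (show 0 < 1 + η by linarith)]
    rw [← Real.rpow_add two_pos]
    exact Real.rpow_lt_rpow_of_exponent_lt one_lt_two (by linarith)
  have hlim := tendsto_pow_atTop_nhds_zero_of_lt_one hq0.le hq1
  obtain ⟨n, hn, hn'⟩ := (h.and (hlim.eventually (gt_mem_nhds (show (0 : ℝ) < 1 / 2 by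
    norm_num)))).exists
  have hpos : (0 : ℝ) < ((2 : ℝ) ^ c) ^ n := by positivity
  have e : (2 : ℝ) ^ (n * c) = ((2 : ℝ) ^ c) ^ n := by
    rw [← Real.rpow_natCast, ← Real.rpow_mul two_pos.le, mul_comm]
  have h1 : q ^ n * ((2 : ℝ) ^ c) ^ n = ((2 : ℝ) ^ R) ^ n * (1 + η) ^ n := by
    rw [← mul_pow, ← mul_pow, hq]
    congr 1
    field_simp
  have h2 := mul_le_mul_of_nonneg_right (numMessages_le n R)
    (show 0 ≤ (1 + η) ^ n by positivity)
  rw [e] at hn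
  nlinarith [mul_lt_mul_of_pos_right hn' hpos]

/-- Change of measure: if typical sequences make `∏ (r + η)` large only at the expense of rate,
then the mean of `log r` is a lower bound for the rate. -/
theorem sum_mul_logb_le_of_forall {S : Type*} [Fintype S] {T r : S → ℝ} (h0 : ∀ s, 0 ≤ T s)
    (hr0 : ∀ s, 0 ≤ r s) (hr : ∀ s, 0 < T s → 0 < r s) {R : ℝ}
    (h : ∀ η > 0, ∀ γ > 0, ∃ R' ≤ R + γ, ∀ᶠ n : ℕ in atTop, ∀ B : ℝ,
      (∀ s : Fin n → S, tvDist (empiricalDist s) T ≤ γ → B ≤ ∏ i, (r (s i) + η)) →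
        1 / 2 * B ≤ numMessages n R' * (1 + η) ^ n) :
    ∑ s, T s * Real.logb 2 (r s) ≤ R := by
  refine le_of_forall_pos_le_add fun e he => ?_
  have hl : 0 < Real.log 2 := Real.log_pos one_lt_two
  -- The shift keeps logarithms meaningful at letters of ratio 0, which a typical sequence may
  -- contain in small proportion. Since log(1+η) ≤ η, its cost is at most e/2; `γ` spends the other
  -- half on the type deviation and the rate slack.
  set η := e / 2 * Real.log 2 with hη
  have hη0 : 0 < η := by positivity
  have hηe : Real.logb 2 (1 + η) ≤ e / 2 := by
    rw [Real.logb, div_le_iff₀ hl]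
    linarith [Real.log_le_sub_one_of_pos (show 0 < 1 + η by linarith)]
  have hpos : ∀ s, 0 < r s + η := fun s => add_pos_of_nonneg_of_pos (hr0 s) hη0
  obtain ⟨C, hC0, hC⟩ := exists_abs_le fun s => Real.logb 2 (r s + η)
  set γ := e / 2 / (2 * C + 1) with hγ
  have hγ0 : 0 < γ := by positivity
  have hγe : 2 * C * γ + γ = e / 2 := by rw [hγ]; field_simp
  obtain ⟨R', hR', hn⟩ := h η hη0 γ hγ0
  have hmean : ∑ s, T s * Real.logb 2 (r s) ≤ ∑ s, T s * Real.logb 2 (r s + η) := by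
    refine Finset.sum_le_sum fun s _ => ?_
    rcases (h0 s).eq_or_lt with hs | hs
    · simp [← hs]
    · exact mul_le_mul_of_nonneg_left
        (Real.logb_le_logb_of_le one_lt_two (hr s hs) (by linarith)) hs.le
  have := sub_logb_le_of_eventually (R := R')
    (c := ∑ s, T s * Real.logb 2 (r s + η) - 2 * C * γ) hη0 (by
      filter_upwards [hn] with n hn
      refine hn _ fun s hs => ?_
      exact (prod_mem_Icc_of_typical T (fun s => r s + η) s (fun i => hpos _) hC
        (mul_le_mul_of_nonneg_left hs (by positivity))).1)
  linarith

variable {X Y X₁ X₂ : Type*} [Fintype X] [Fintype Y] [Fintype X₁] [Fintype X₂]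

/-- A union bound over messages, after a change of measure. -/
theorem half_mul_le_of_errorProb_le {n M₁ M₂ M : ℕ} (K : CascadeCode X Y X₁ X₂ n M₁ M₂)
    (P₀ : stdSimplex ℝ (X × Y)) (T : X × Y × X₁ × X₂ → ℝ) {γ B E : ℝ}
    (herr : K.errorProb P₀ T γ ≤ 1 / 2)
    (G : Fin M → (Fin n → X) → (Fin n → Y) → ℝ) (hG0 : ∀ m x y, 0 ≤ G m x y)
    (hG : ∀ x y, tvDist (empiricalDist (K.output x y)) T ≤ γ → B ≤ ∑ m, G m x y)
    (hE : ∀ m, ∑ x, ∑ y, (∏ i, P₀ (x i, y i)) * G m x y ≤ E) (hB : 0 ≤ B) :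
    1 / 2 * B ≤ M * E := by
  classical
  have hp : ∀ (x : Fin n → X) (y : Fin n → Y), 0 ≤ ∏ i, P₀ (x i, y i) :=
    fun x y => Finset.prod_nonneg fun i _ => P₀.2.1 _
  have hone : ∑ x : Fin n → X, ∑ y : Fin n → Y, ∏ i, P₀ (x i, y i) = 1 := by
    rw [sum_prod_seq₂ fun _ x y => P₀ (x, y), ← Fintype.sum_prod_type (f := fun a => P₀ a)]
    have : ∑ a, P₀ a = 1 := P₀.2.2
    simp [this]
  have hsum : B ≤ K.errorProb P₀ T γ * B +
      ∑ x, ∑ y, (∏ i, P₀ (x i, y i)) * ∑ m, G m x y := by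
    calc B = ∑ x : Fin n → X, ∑ y : Fin n → Y, (∏ i, P₀ (x i, y i)) * B := by
          simp_rw [← Finset.sum_mul, hone, one_mul]
      _ ≤ _ := by
          rw [CascadeCode.errorProb, Finset.sum_mul, ← Finset.sum_add_distrib]
          refine Finset.sum_le_sum fun x _ => ?_
          rw [Finset.sum_mul, ← Finset.sum_add_distrib]
          refine Finset.sum_le_sum fun y _ => ?_
          have hs : 0 ≤ ∑ m, G m x y := Finset.sum_nonneg fun m _ => hG0 m x y
          split_ifs with h
          · exact le_add_of_nonneg_right (mul_nonneg (hp x y) hs)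
          · rw [zero_mul, zero_add]
            exact mul_le_mul_of_nonneg_left (hG x y (not_lt.1 h)) (hp x y)
  have hswap : ∑ x, ∑ y, (∏ i, P₀ (x i, y i)) * ∑ m, G m x y ≤ M * E := by
    simp_rw [Finset.mul_sum]
    rw [Finset.sum_congr rfl fun x _ => Finset.sum_comm, Finset.sum_comm]
    refine (Finset.sum_le_sum fun m _ => hE m).trans ?_
    simp
  nlinarith [mul_le_mul_of_nonneg_right herr hB]

-- Multiplying by `condRatio` turns P(x, y) into P(y)P(x | y, w, v), whose sum over x is at most
-- P(y); null events only lower the sum.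
omit [Fintype Y] in
theorem sum_margXY_mul_condRatio_le {T : X × Y × X₁ × X₂ → ℝ} (h0 : ∀ s, 0 ≤ T s) (η : ℝ)
    (y : Y) (w : X₁) (v : X₂) :
    ∑ x, margXY T x y * (condRatio T (x, y, w, v) + η) ≤ (1 + η) * margY T y := by
  simp only [mul_add, Finset.sum_add_distrib, ← Finset.sum_mul]
  have hle : ∀ x, margXY T x y * condRatio T (x, y, w, v) ≤
      T (x, y, w, v) * (margY T y / margYWV T y w v) := by
    intro x
    have : margXY T x y * condRatio T (x, y, w, v) = (margXY T x y / margXY T x y) *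
        (T (x, y, w, v) * (margY T y / margYWV T y w v)) := by
      simp only [condRatio]; ring
    rw [this]
    exact mul_le_of_le_one_left (mul_nonneg (h0 _)
      (div_nonneg (margY_nonneg h0 _) (margYWV_nonneg h0 _ _ _))) (div_self_le_one _)
  have h1 : ∑ x, margXY T x y * condRatio T (x, y, w, v) ≤ margY T y := by
    refine (Finset.sum_le_sum fun x _ => hle x).trans ?_
    rw [← Finset.sum_mul, show ∑ x, T (x, y, w, v) = margYWV T y w v from rfl]
    rw [show margYWV T y w v * (margY T y / margYWV T y w v) =
      margYWV T y w v / margYWV T y w v * margY T y by ring]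
    exact mul_le_of_le_one_left (margY_nonneg h0 _) (div_self_le_one _)
  have h2 : ∑ x, margXY T x y = margY T y := rfl
  rw [h2]
  linarith

/-- Multiplying by `pairRatio` turns P(x, y) into P(x, y | v), up to null events. -/
theorem sum_margXY_mul_pairRatio_le {T : X × Y × X₁ × X₂ → ℝ} (h0 : ∀ s, 0 ≤ T s)
    (h1 : ∑ s, T s = 1) (η : ℝ) (w : X₁) (v : X₂) :
    ∑ x, ∑ y, margXY T x y * (pairRatio T (x, y, w, v) + η) ≤ 1 + η := by
  simp only [mul_add, Finset.sum_add_distrib, ← Finset.sum_mul]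
  rw [sum_margXY, h1, one_mul]
  refine add_le_add_left ?_ _
  have hle : ∀ x y, margXY T x y * pairRatio T (x, y, w, v) ≤
      margXYV T x y v / margV T v := by
    intro x y
    have : margXY T x y * pairRatio T (x, y, w, v) = (margXY T x y / margXY T x y) *
        (margXYV T x y v / margV T v) := by
      simp only [pairRatio]; ring
    rw [this]
    exact mul_le_of_le_one_left (div_nonneg (margXYV_nonneg h0 _ _ _) (margV_nonneg h0 _))
      (div_self_le_one _)
  refine (Finset.sum_le_sum fun x _ => Finset.sum_le_sum fun y _ => hle x y).trans ?_
  simp only [← Finset.sum_div]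
  rw [← Fintype.sum_prod_type (f := fun a : X × Y => margXYV T a.1 a.2 v), sum_margXYV_prod]
  exact div_self_le_one _

theorem half_mul_le_first_link {n M₁ M₂ : ℕ} (K : CascadeCode X Y X₁ X₂ n M₁ M₂)
    (P₀ : stdSimplex ℝ (X × Y)) {T : X × Y × X₁ × X₂ → ℝ} (h0 : ∀ s, 0 ≤ T s)
    (h1 : ∑ s, T s = 1) (hp : ∀ x y, margXY T x y = P₀ (x, y)) {γ η B : ℝ} (hη : 0 < η)
    (herr : K.errorProb P₀ T γ ≤ 1 / 2)
    (hB : ∀ s : Fin n → X × Y × X₁ × X₂, tvDist (empiricalDist s) T ≤ γ →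
      B ≤ ∏ i, (condRatio T (s i) + η)) : 1 / 2 * B ≤ M₁ * (1 + η) ^ n := by
  have hpos : ∀ s, 0 < condRatio T s + η := fun s =>
    add_pos_of_nonneg_of_pos (condRatio_nonneg h0 s) hη
  rcases le_or_gt B 0 with hB0 | hB0
  · exact (by linarith : 1 / 2 * B ≤ 0).trans (by positivity)
  -- For fixed m and y both reconstructions are fixed sequences, because User 2's message is a
  -- function of (y, m). The sum over x therefore factors over letters.
  let G : Fin M₁ → (Fin n → X) → (Fin n → Y) → ℝ := fun m x y =>
    ∏ i, (condRatio T (x i, y i, K.g₁ y m i, K.g₂ (K.f₂ y m) i) + η)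
  have hG0 : ∀ m x y, 0 ≤ G m x y := fun m x y => Finset.prod_nonneg fun i _ => (hpos _).le
  refine half_mul_le_of_errorProb_le K P₀ T herr G hG0 (fun x y hs => ?_) (fun m => ?_) hB0.le
  · exact (hB _ hs).trans (Finset.single_le_sum (f := fun m => G m x y) (fun m _ => hG0 m x y)
      (Finset.mem_univ (K.f₁ x y)))
  · rw [Finset.sum_comm]
    have hy : ∀ y : Fin n → Y, ∑ x : Fin n → X, (∏ i, P₀ (x i, y i)) * G m x y ≤
        ∏ i, (1 + η) * margY T (y i) := by
      intro y
      simp only [G, ← Finset.prod_mul_distrib, ← hp]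
      rw [sum_prod_seq fun i x => margXY T x (y i) *
        (condRatio T (x, y i, K.g₁ y m i, K.g₂ (K.f₂ y m) i) + η)]
      exact Finset.prod_le_prod (fun i _ => Finset.sum_nonneg fun x _ =>
        mul_nonneg (margXY_nonneg h0 _ _) (hpos _).le)
        fun i _ => sum_margXY_mul_condRatio_le h0 η _ _ _
    refine (Finset.sum_le_sum fun y _ => hy y).trans (le_of_eq ?_)
    rw [sum_prod_seq fun _ y => (1 + η) * margY T y]
    simp [← Finset.mul_sum, sum_margY, h1]

theorem half_mul_le_second_link {n M₁ M₂ : ℕ} (K : CascadeCode X Y X₁ X₂ n M₁ M₂)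
    (P₀ : stdSimplex ℝ (X × Y)) {T : X × Y × X₁ × X₂ → ℝ} (h0 : ∀ s, 0 ≤ T s)
    (h1 : ∑ s, T s = 1) (hp : ∀ x y, margXY T x y = P₀ (x, y)) {γ η B : ℝ} (hη : 0 < η)
    (herr : K.errorProb P₀ T γ ≤ 1 / 2)
    (hB : ∀ s : Fin n → X × Y × X₁ × X₂, tvDist (empiricalDist s) T ≤ γ →
      B ≤ ∏ i, (pairRatio T (s i) + η)) (w : X₁) : 1 / 2 * B ≤ M₂ * (1 + η) ^ n := by
  have hpos : ∀ s, 0 < pairRatio T s + η := fun s =>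
    add_pos_of_nonneg_of_pos (pairRatio_nonneg h0 s) hη
  rcases le_or_gt B 0 with hB0 | hB0
  · exact (by linarith : 1 / 2 * B ≤ 0).trans (by positivity)
  -- `pairRatio` ignores User 1's letter, so an arbitrary `w` stands in for it, and User 2's
  -- sequence depends on m alone. The sum over (x, y) then factors.
  let G : Fin M₂ → (Fin n → X) → (Fin n → Y) → ℝ := fun m x y =>
    ∏ i, (pairRatio T (x i, y i, w, K.g₂ m i) + η)
  have hG0 : ∀ m x y, 0 ≤ G m x y := fun m x y => Finset.prod_nonneg fun i _ => (hpos _).le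
  refine half_mul_le_of_errorProb_le K P₀ T herr G hG0 (fun x y hs => ?_) (fun m => ?_) hB0.le
  · exact (hB _ hs).trans (Finset.single_le_sum (f := fun m => G m x y) (fun m _ => hG0 m x y)
      (Finset.mem_univ (K.f₂ y (K.f₁ x y))))
  · simp only [G, ← Finset.prod_mul_distrib, ← hp]
    rw [sum_prod_seq₂ fun i x y => margXY T x y * (pairRatio T (x, y, w, K.g₂ m i) + η)]
    refine (Finset.prod_le_prod (fun i _ => Finset.sum_nonneg fun x _ =>
      Finset.sum_nonneg fun y _ => mul_nonneg (margXY_nonneg h0 _ _) (hpos _).le)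
      fun i _ => sum_margXY_mul_pairRatio_le h0 h1 η w _).trans ?_
    simp

/-- The converse, in a form that is robust under perturbations of rates and target. -/
theorem mem_informationRegion_of_forall (P₀ : stdSimplex ℝ (X × Y))
    (Q : X × Y → stdSimplex ℝ (X₁ × X₂)) {R : ℝ × ℝ}
    (h : ∀ γ > 0, ∃ R' : ℝ × ℝ, R'.1 ≤ R.1 + γ ∧ R'.2 ≤ R.2 + γ ∧ ∀ᶠ n in atTop,
      ∃ K : CascadeCode X Y X₁ X₂ n (numMessages n R'.1) (numMessages n R'.2),
        K.errorProb P₀ (targetDist P₀ Q) γ ≤ 1 / 2) : R ∈ informationRegion P₀ Q := by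
  have h0 := targetDist_nonneg P₀ Q
  have h1 := sum_targetDist P₀ Q
  have hp := margXY_targetDist P₀ Q
  rw [informationRegion, Set.mem_ofPred_eq, mutualInfo_eq_sum, condMutualInfo_eq_sum]
  obtain ⟨s⟩ := nonempty_of_targetDist P₀ Q
  constructor
  · refine sum_mul_logb_le_of_forall h0 (pairRatio_nonneg h0) (fun _ => pairRatio_pos h0) ?_
    intro η hη γ hγ
    obtain ⟨R', -, h2, h3⟩ := h γ hγ
    refine ⟨R'.2, h2, ?_⟩
    filter_upwards [h3] with n hn B hB
    obtain ⟨K, hK⟩ := hn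
    exact half_mul_le_second_link K P₀ h0 h1 hp hη hK hB s.2.2.1
  · refine sum_mul_logb_le_of_forall h0 (condRatio_nonneg h0) (fun _ => condRatio_pos h0) ?_
    intro η hη γ hγ
    obtain ⟨R', h2, -, h3⟩ := h γ hγ
    refine ⟨R'.1, h2, ?_⟩
    filter_upwards [h3] with n hn B hB
    obtain ⟨K, hK⟩ := hn
    exact half_mul_le_first_link K P₀ h0 h1 hp hη hK hB

/-- The mean error over ω is eventually at most 1/2, so some value of ω does at least as well. -/
theorem AchievableCR.eventually_exists_code {P₀ : stdSimplex ℝ (X × Y)}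
    {Q : X × Y → stdSimplex ℝ (X₁ × X₂)} {R : ℝ × ℝ} (h : AchievableCR P₀ Q R) {ε : ℝ}
    (hε : 0 < ε) : ∀ᶠ n in atTop,
      ∃ K : CascadeCode X Y X₁ X₂ n (numMessages n R.1) (numMessages n R.2),
        K.errorProb P₀ (targetDist P₀ Q) ε ≤ 1 / 2 := by
  obtain ⟨N, p, C, hC⟩ := h
  filter_upwards [(hC ε hε).eventually (ge_mem_nhds (show (0 : ℝ) < 1 / 2 by norm_num))] with n hn
  obtain ⟨ω, hω⟩ := exists_le_of_sum_mul_le (fun ω => p n ω) _ (p n).2.1 (p n).2.2 hn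
  exact ⟨C n ω, hω⟩

theorem continuous_tvDist_targetDist (P₀ : stdSimplex ℝ (X × Y)) (T : X × Y × X₁ × X₂ → ℝ) :
    Continuous fun Q : X × Y → stdSimplex ℝ (X₁ × X₂) => tvDist (targetDist P₀ Q) T := by
  have hQ : ∀ (a : X × Y) (b : X₁ × X₂),
      Continuous fun Q : X × Y → stdSimplex ℝ (X₁ × X₂) => Q a b := fun a b =>
    (continuous_apply b).comp (continuous_subtype_val.comp (continuous_apply a))
  unfold tvDist targetDist
  refine continuous_const.mul (continuous_finsetSum _ fun s _ => ?_)
  exact ((continuous_const.mul (hQ _ _)).sub continuous_const).abs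

theorem rateCoordinationRegion_subset (P₀ : stdSimplex ℝ (X × Y))
    (Q : X × Y → stdSimplex ℝ (X₁ × X₂)) :
    rateCoordinationRegion P₀ Q ⊆ informationRegion P₀ Q := by
  intro R hR
  refine mem_informationRegion_of_forall P₀ Q fun γ hγ => ?_
  -- A point of the closure has achievable tuples nearby. Half of the tolerance pays for the
  -- perturbed target and half for the code, so continuity of the informations is not needed.
  have hU : ∀ᶠ t : (ℝ × ℝ) × (X × Y → stdSimplex ℝ (X₁ × X₂)) in 𝓝 (R, Q),
      t.1.1 < R.1 + γ ∧ t.1.2 < R.2 + γ ∧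
        tvDist (targetDist P₀ t.2) (targetDist P₀ Q) < γ / 2 := by
    refine ((continuous_fst.comp continuous_fst).tendsto _ |>.eventually
      (gt_mem_nhds (by simpa using hγ))).and
      (((continuous_snd.comp continuous_fst).tendsto _ |>.eventually
        (gt_mem_nhds (by simpa using hγ))).and ?_)
    refine (((continuous_tvDist_targetDist P₀ (targetDist P₀ Q)).comp
      continuous_snd).tendsto (R, Q)).eventually (gt_mem_nhds ?_)
    simpa [tvDist_self] using hγ
  obtain ⟨t, ⟨ht1, ht2, ht3⟩, ht⟩ := mem_closure_iff_nhds.1 hR _ hU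
  refine ⟨t.1, ht1.le, ht2.le, ?_⟩
  filter_upwards [AchievableCR.eventually_exists_code ht (half_pos hγ)] with n hn
  obtain ⟨K, hK⟩ := hn
  exact ⟨K, (errorProb_anti K P₀ (by linarith)).trans hK⟩

end Converse

/-! ### Inclusions between the regions -/

section Regions

variable {X Y X₁ X₂ : Type*} [Fintype X] [Fintype Y] [Fintype X₁] [Fintype X₂]

theorem Achievable.achievableCR {P₀ : stdSimplex ℝ (X × Y)}
    {Q : X × Y → stdSimplex ℝ (X₁ × X₂)} {R : ℝ × ℝ} (h : Achievable P₀ Q R) :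
    AchievableCR P₀ Q R := by
  obtain ⟨C, hC⟩ := h
  refine ⟨fun _ => 1, fun _ => ⟨fun _ => 1, fun _ => zero_le_one, by simp⟩, fun n _ => C n,
    fun ε hε => (hC ε hε).congr fun n => ?_⟩
  rw [Fin.sum_univ_one]
  exact (one_mul _).symm

theorem achievableRegion_subset (P₀ : stdSimplex ℝ (X × Y))
    (Q : X × Y → stdSimplex ℝ (X₁ × X₂)) :
    achievableRegion P₀ Q ⊆ rateCoordinationRegion P₀ Q := by
  intro R hR
  exact map_mem_closure (f := fun R : ℝ × ℝ => (R, Q)) (by fun_prop) hR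
    fun R' hR' => Achievable.achievableCR hR'

/-- Raising both rates by 1/(k+1) makes the inequalities strict, hence the pair achievable; the
closure takes the limit. -/
theorem informationRegion_subset (P₀ : stdSimplex ℝ (X × Y))
    (Q : X × Y → stdSimplex ℝ (X₁ × X₂)) :
    informationRegion P₀ Q ⊆ achievableRegion P₀ Q := by
  intro R hR
  rw [informationRegion, Set.mem_ofPred_eq, mutualInfo_eq_sum, condMutualInfo_eq_sum] at hR
  have hlim : Tendsto (fun k : ℕ => (R.1 + 1 / ((k : ℝ) + 1), R.2 + 1 / ((k : ℝ) + 1))) atTop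
      (𝓝 R) := by
    have h := tendsto_one_div_add_atTop_nhds_zero_nat (𝕜 := ℝ)
    simpa using (h.const_add R.1).prodMk_nhds (h.const_add R.2)
  refine mem_closure_of_tendsto hlim (Eventually.of_forall fun k => ?_)
  have hk : (0 : ℝ) < 1 / ((k : ℝ) + 1) := by positivity
  exact achievable_of_lt P₀ Q (by simpa using hR.2.trans_lt (lt_add_of_pos_right _ hk))
    (by simpa using hR.1.trans_lt (lt_add_of_pos_right _ hk))

end Regions

theorem mainTheorem8 {X Y X₁ X₂ : Type*} [Fintype X] [Fintype Y] [Fintype X₁] [Fintype X₂]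
    (P₀ : stdSimplex ℝ (X × Y)) (Q : X × Y → stdSimplex ℝ (X₁ × X₂)) :
    rateCoordinationRegion P₀ Q = informationRegion P₀ Q ∧
      achievableRegion P₀ Q = informationRegion P₀ Q :=
  ⟨(rateCoordinationRegion_subset P₀ Q).antisymm
      ((informationRegion_subset P₀ Q).trans (achievableRegion_subset P₀ Q)),
    ((achievableRegion_subset P₀ Q).trans (rateCoordinationRegion_subset P₀ Q)).antisymm
      (informationRegion_subset P₀ Q)⟩
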